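/- Let $n,p,k\in\mathbb N$ with $n>p+1$, let $\bm X\in\mathbb R^{n\times p}$ be a fixed matrix of rank $p$, and let $\mathcal P_{n,m}$ be the set of $n\times n$ permutation matrices $\Pi$ with $d(\Pi,I_n):=\#\{i:\Pi_{ii}=0\}\le m$. For a matrix $\bm A$ with $n$ rows, $M_{\bm A}$ is the orthogonal projection of $\mathbb R^n$ onto the range of $\bm A$. Let $\Pi_0\in\mathcal P_{n,k}$, $\bm\beta_0\in\mathbb R^p$, $\sigma_0>0$, let $\bm U,\bm U_1,\dots,\bm U_L$ be i.i.d. $\mathrm N(0,I_n)$, $\mathcal U^L=(\bm U_1,\dots,\bm U_L)$, and $\bm Y=\Pi_0\bm X\bm\beta_0+\sigma_0\bm U$. Assume $$C_{\min}(\Pi_0)=\min_{\Pi\in\mathcal P_{n,k},\,\Pi\ne\Pi_0}\frac{\|(I_n-\Pi M_{\bm X}\Pi^\top)\Pi_0\bm X\bm\beta_0\|_2^2}{n\max(d(\Pi_0,I_n)-d(\Pi,I_n),1)}>0$$ (the minimum over the empty set being $+\infty$). *The test.* For $y\in\mathbb R^n$ let $\mathcal C^{(L)}(y)=\{\hat\Pi_1(y),\dots,\hat\Pi_L(y)\}$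 with $\hat\Pi_\ell(y)\in\arg\min_{\Pi\in\mathcal P_{n,k}}\|(I_n-M_{(\Pi\bm X,\bm U_\ell)})y\|_2^2$, and let $D(y)=d(\hat\Pi(y),I_n)$ with $\hat\Pi(y)\in\arg\min_{\Pi\in\mathcal C^{(L)}(y)}\|(I_n-M_{\Pi\bm X})y\|_2^2$; minimizers are chosen by arbitrary measurable tie-breaking rules. Put $S_{1,\Pi}(y)=M_{\Pi\bm X}y$ and $S_{2,\Pi}(y)=\|(I_n-M_{\Pi\bm X})y\|_2$. Let $Q_\Pi(s_1,s_2)$ be the law of $s_1+s_2\,(I_n-M_{\Pi\bm X})\bm V/\|(I_n-M_{\Pi\bm X})\bm V\|_2$ with $\bm V\sim\mathrm N(0,I_n)$ independent of $\mathcal U^L$. Let $\hat c_{1-\alpha}(\Pi)$ be the $(1-\alpha)$-quantile of $D(\bm Y^*)$ given $\mathcal U^L$, where $\bm Y^*\sim Q_\Pi(S_{1,\Pi}(\bm Y),S_{2,\Pi}(\bm Y))$. For $k_0\le k$ set $\hat c^{(k_0)}_{1-\alpha}=\max\{\hat c_{1-\alpha}(\Pi):\Pi\in\mathcal C^{(L)}(\bm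 Y)\cap\mathcal P_{n,k_0}\}$ and $\hat B^{(k_0)}_{1-\alpha}=\{0,1,\dots,\hat c^{(k_0)}_{1-\alpha}\}$ ($\hat B^{(k_0)}_{1-\alpha}=\emptyset$ if the maximum is over the empty set). The hypothesis $H_0:\Pi_0\in\mathcal P_{n,k_0}$ is rejected when $D(\bm Y)\notin\hat B^{(k_0)}_{1-\alpha}$. *Claim.* (i) There is a positive sequence $(\delta_L)$, not depending on the tie-breaking rules, with $$\mathbb P_{(\mathcal U^L,\bm U)}\big(\Pi_0\notin\mathcal C^{(L)}(\bm Y)\big)\le\delta_L\ \ (L\ge2),\qquad \delta_L=O\!\left(\frac{(\log L)^{(n-p)/2}}{L^{(n-p-1)/(2(n-1))}}\right)\ \ (L\to\infty).\tag{1}$$ (ii) For all $\Pi\in\mathcal P_{n,k}$, $\bm\beta\in\mathbb R^p$, $\sigma>0$, with $\bm Y_{\bm\theta}=\Pi\bm X\bm\beta+\sigma\bm U$, the conditional distribution of $\bm Y_{\bm\theta}$ given $(S_{1,\Pi}(\bm Y_{\bm\theta}),S_{2,\Pi}(\bm Y_{\bm\theta}))$ is $Q_\Pi(S_{1,\Pi}(\bm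 Y_{\bm\theta}),S_{2,\Pi}(\bm Y_{\bm\theta}))$. (iii) For every positive sequence $(\delta_L)$ satisfying (1), every $k_0\le k$ with $\Pi_0\in\mathcal P_{n,k_0}$, every $\alpha\in(0,1)$ and every $L\ge2$, $$\mathbb P_{(\mathcal U^L,\bm U)}\big(D(\bm Y)\notin\hat B^{(k_0)}_{1-\alpha}\big)\le\alpha+\delta_L .$$ -/

import Mathlib

open MeasureTheory ProbabilityTheory Filter

noncomputable section

/-- The Euclidean space `ℝⁿ`. -/
abbrev Vec (n : ℕ) : Type := EuclideanSpace ℝ (Fin n)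

/-- `d(Π, Iₙ)`: the number of zero diagonal entries of the permutation matrix of `π`. -/
def permDist {n : ℕ} (π : Equiv.Perm (Fin n)) : ℕ :=
  (Finset.univ.filter fun i => π.permMatrix ℝ i i = 0).card

/-- `𝒫_{n,k}`: the permutations whose matrix `Π` satisfies `d(Π, Iₙ) ≤ k`. -/
def sparsePerms (n k : ℕ) : Finset (Equiv.Perm (Fin n)) :=
  Finset.univ.filter fun π => permDist π ≤ k

/-- The permuted design `Π X`. -/
def permDesign {n p : ℕ} (X : Matrix (Fin n) (Fin p) ℝ) (π : Equiv.Perm (Fin n)) :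
    Matrix (Fin n) (Fin p) ℝ :=
  π.permMatrix ℝ * X

/-- The augmented design `(A, u)`: the matrix `A` with the extra column `u`. -/
def appendCol {n p : ℕ} (A : Matrix (Fin n) (Fin p) ℝ) (u : Vec n) :
    Matrix (Fin n) (Fin p ⊕ Unit) ℝ :=
  Matrix.fromCols A (Matrix.replicateCol Unit (fun i => u i))

/-- `M_A`: the orthogonal projection of `ℝⁿ` onto the range of the matrix `A`. -/
def rangeProj {n : ℕ} {ι : Type} [Fintype ι] [DecidableEq ι] (A : Matrix (Fin n) ι ℝ) :
    Vec n →L[ℝ] Vec n :=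
  (LinearMap.range (Matrix.toEuclideanLin A)).starProjection

/-- `(Iₙ - M_A) y`. -/
def resid {n : ℕ} {ι : Type} [Fintype ι] [DecidableEq ι] (A : Matrix (Fin n) ι ℝ)
    (y : Vec n) : Vec n :=
  y - rangeProj A y

/-- The mean vector `Π X β`. -/
def meanVec {n p : ℕ} (X : Matrix (Fin n) (Fin p) ℝ) (π : Equiv.Perm (Fin n))
    (β : Fin p → ℝ) : Vec n :=
  WithLp.toLp 2 ((permDesign X π).mulVec β)

/-- The data `Y_θ = Π X β + σ U` for `θ = (Π, β, σ)`. -/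
def response {n p : ℕ} (X : Matrix (Fin n) (Fin p) ℝ) (π : Equiv.Perm (Fin n))
    (β : Fin p → ℝ) (σ : ℝ) (U : Vec n) : Vec n :=
  meanVec X π β + σ • U

/-- The separation ratio
`‖(Iₙ - Π M_X Πᵀ) Π₀ X β₀‖² / (n · max (d(Π₀, Iₙ) - d(Π, Iₙ), 1))`. -/
def separation {n p : ℕ} (X : Matrix (Fin n) (Fin p) ℝ) (π₀ : Equiv.Perm (Fin n))
    (β₀ : Fin p → ℝ) (π : Equiv.Perm (Fin n)) : ℝ :=
  ‖meanVec X π₀ β₀ - Matrix.toEuclideanLin (π.permMatrix ℝ)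
      (rangeProj X (Matrix.toEuclideanLin (π.permMatrix ℝ).transpose (meanVec X π₀ β₀)))‖ ^ 2
    / ((n : ℝ) * max ((permDist π₀ : ℝ) - (permDist π : ℝ)) 1)

/-- `C_min(Π₀)`: the minimum of the separation ratio over `Π ∈ 𝒫_{n,k}`, `Π ≠ Π₀`
(`⊤` when there is no such `Π`). -/
def Cmin {n p : ℕ} (k : ℕ) (X : Matrix (Fin n) (Fin p) ℝ) (π₀ : Equiv.Perm (Fin n))
    (β₀ : Fin p → ℝ) : EReal :=
  ((sparsePerms n k).erase π₀).inf fun π => (separation X π₀ β₀ π : EReal)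

/-- The repro objective `‖(Iₙ - M_{(ΠX, u)}) y‖²`. -/
def reproObj {n p : ℕ} (X : Matrix (Fin n) (Fin p) ℝ) (y u : Vec n)
    (π : Equiv.Perm (Fin n)) : ℝ :=
  ‖resid (appendCol (permDesign X π) u) y‖ ^ 2

/-- The least-squares objective `‖(Iₙ - M_{ΠX}) y‖²`. -/
def lsObj {n p : ℕ} (X : Matrix (Fin n) (Fin p) ℝ) (y : Vec n)
    (π : Equiv.Perm (Fin n)) : ℝ :=
  ‖resid (permDesign X π) y‖ ^ 2

/-- `sel y u` is a measurable choice of a minimizer over `𝒫_{n,k}` of the repro objective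
(any rule for breaking ties is allowed). -/
structure IsReproRule {n p : ℕ} (k : ℕ) (X : Matrix (Fin n) (Fin p) ℝ)
    (sel : Vec n → Vec n → Equiv.Perm (Fin n)) : Prop where
  mem : ∀ y u, sel y u ∈ sparsePerms n k
  isMin : ∀ y u, ∀ π ∈ sparsePerms n k, reproObj X y u (sel y u) ≤ reproObj X y u π
  meas : ∀ π, MeasurableSet {z : Vec n × Vec n | sel z.1 z.2 = π}

/-- `ls C y` is, for every nonempty set `C` of permutations, a measurable choice of a minimizer
over `C` of the least-squares objective (any rule for breaking ties is allowed). -/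
structure IsLSRule {n p : ℕ} (X : Matrix (Fin n) (Fin p) ℝ)
    (ls : Finset (Equiv.Perm (Fin n)) → Vec n → Equiv.Perm (Fin n)) : Prop where
  mem : ∀ C, C.Nonempty → ∀ y, ls C y ∈ C
  isMin : ∀ C, C.Nonempty → ∀ y, ∀ π ∈ C, lsObj X y (ls C y) ≤ lsObj X y π
  meas : ∀ C π, MeasurableSet {y : Vec n | ls C y = π}

/-- The candidate set `𝒞^(L) = {Π̂_1, …, Π̂_L}` computed from the data `y` and the repro samples
`u_1, …, u_L`. -/
def candidateSet {n : ℕ} (sel : Vec n → Vec n → Equiv.Perm (Fin n)) {L : ℕ}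
    (u : Fin L → Vec n) (y : Vec n) : Finset (Equiv.Perm (Fin n)) :=
  Finset.univ.image fun l => sel y (u l)

/-- The statistic `D(y) = d(Π̂(y), Iₙ)`, where `Π̂(y)` is the least-squares fit over the
candidate set. -/
def statD {n : ℕ} (sel : Vec n → Vec n → Equiv.Perm (Fin n))
    (ls : Finset (Equiv.Perm (Fin n)) → Vec n → Equiv.Perm (Fin n)) {L : ℕ}
    (u : Fin L → Vec n) (y : Vec n) : ℕ :=
  permDist (ls (candidateSet sel u y) y)

/-- The sufficient statistics `(S_{1,Π}(y), S_{2,Π}(y)) = (M_{ΠX} y, ‖(Iₙ - M_{ΠX}) y‖)`. -/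
def suffStat {n p : ℕ} (X : Matrix (Fin n) (Fin p) ℝ) (π : Equiv.Perm (Fin n))
    (y : Vec n) : Vec n × ℝ :=
  (rangeProj (permDesign X π) y, ‖resid (permDesign X π) y‖)

/-- The law of `s₁ + s₂ (Iₙ - M_{ΠX}) U / ‖(Iₙ - M_{ΠX}) U‖` with `U ∼ N(0, Iₙ)`: the conditional
distribution of `Y` given `(S_{1,Π}(Y), S_{2,Π}(Y)) = (s₁, s₂)`. -/
def condLaw {n p : ℕ} (X : Matrix (Fin n) (Fin p) ℝ) (π : Equiv.Perm (Fin n))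
    (s : Vec n × ℝ) : Measure (Vec n) :=
  (stdGaussian (Vec n)).map fun U =>
    s.1 + (s.2 / ‖resid (permDesign X π) U‖) • resid (permDesign X π) U

/-- The `q`-quantile `min {c | μ (T ≤ c) ≥ q}` of an `ℕ`-valued statistic `T` under the law `μ`. -/
def natQuantile {n : ℕ} (μ : Measure (Vec n)) (T : Vec n → ℕ) (q : ℝ) : ℕ :=
  sInf {c : ℕ | ENNReal.ofReal q ≤ μ {y | T y ≤ c}}

/-- `ĉ_{1-α}(Π)`: the `(1-α)`-quantile of the distribution of `D(Y)` conditionally on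
`(S_{1,Π}(Y), S_{2,Π}(Y))` being equal to its observed value at `yobs`, given the repro samples. -/
def critVal {n p : ℕ} (X : Matrix (Fin n) (Fin p) ℝ)
    (sel : Vec n → Vec n → Equiv.Perm (Fin n))
    (ls : Finset (Equiv.Perm (Fin n)) → Vec n → Equiv.Perm (Fin n)) (α : ℝ) {L : ℕ}
    (u : Fin L → Vec n) (yobs : Vec n) (π : Equiv.Perm (Fin n)) : ℕ :=
  natQuantile (condLaw X π (suffStat X π yobs)) (statD sel ls u) (1 - α)

/-- The composite critical value: the maximum of `ĉ_{1-α}(Π)` over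
`Π ∈ 𝒞^(L) ∩ 𝒫_{n,k₀}` (`⊥` when this set is empty). -/
def compositeCrit {n p : ℕ} (k₀ : ℕ) (X : Matrix (Fin n) (Fin p) ℝ)
    (sel : Vec n → Vec n → Equiv.Perm (Fin n))
    (ls : Finset (Equiv.Perm (Fin n)) → Vec n → Equiv.Perm (Fin n)) (α : ℝ) {L : ℕ}
    (u : Fin L → Vec n) (yobs : Vec n) : WithBot ℕ :=
  (candidateSet sel u yobs ∩ sparsePerms n k₀).sup
    fun π => (critVal X sel ls α u yobs π : WithBot ℕ)

/-- The acceptance set `{0, 1, …, ĉ}` for the composite critical value `ĉ` (empty when `ĉ = ⊥`). -/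
def acceptSet {n p : ℕ} (k₀ : ℕ) (X : Matrix (Fin n) (Fin p) ℝ)
    (sel : Vec n → Vec n → Equiv.Perm (Fin n))
    (ls : Finset (Equiv.Perm (Fin n)) → Vec n → Equiv.Perm (Fin n)) (α : ℝ) {L : ℕ}
    (u : Fin L → Vec n) (yobs : Vec n) : Set ℕ :=
  {m : ℕ | (m : WithBot ℕ) ≤ compositeCrit k₀ X sel ls α u yobs}

/-- The joint law of `(𝒰^L, U)`: `L + 1` independent `N(0, Iₙ)` vectors. -/
def jointLaw (n L : ℕ) : Measure ((Fin L → Vec n) × Vec n) :=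
  (Measure.pi fun _ : Fin L => stdGaussian (Vec n)).prod (stdGaussian (Vec n))

/-- `δ` is a positive sequence with `ℙ(Π₀ ∉ 𝒞^(L)) ≤ δ_L` for all `L ≥ 2` and
`δ_L = O((log L)^((n-p)/2) / L^((n-p-1)/(2(n-1))))` as `L → ∞`. -/
structure IsMiscoverageBound {n p : ℕ} (X : Matrix (Fin n) (Fin p) ℝ)
    (π₀ : Equiv.Perm (Fin n)) (β₀ : Fin p → ℝ) (σ₀ : ℝ)
    (sel : Vec n → Vec n → Equiv.Perm (Fin n)) (δ : ℕ → ℝ) : Prop where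
  pos : ∀ L, 0 < δ L
  coverage : ∀ L, 2 ≤ L →
    jointLaw n L {ω | π₀ ∉ candidateSet sel ω.1 (response X π₀ β₀ σ₀ ω.2)}
      ≤ ENNReal.ofReal (δ L)
  rate : δ =O[atTop] fun L : ℕ =>
    Real.log (L : ℝ) ^ (((n : ℝ) - p) / 2)
      / (L : ℝ) ^ (((n : ℝ) - p - 1) / (2 * ((n : ℝ) - 1)))

end

/-! Sufficiency. Write `K` for the column space of `ΠX`. A standard Gaussian vector splits into
independent standard Gaussian vectors of `K` and `Kᗮ`, and the direction of the second is
independent of its norm (`lintegral_stdGaussian_norm_direction`). The statistic sees only the first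
part and that norm, so conditionally the direction is still that of a fresh Gaussian vector of `Kᗮ`
(`map_suffStat_response`).

Level. A rejection forces either `Π₀` to be missing from the candidate set or `D(Y)` to exceed the
critical value of `Π₀` itself. The first event costs `δ_L`. For the second, once the repro samples
are fixed, `D` is a fixed statistic compared with its own conditional quantile, which costs `α`.

Coverage. Suppose a repro sample is within `ε` of the direction `e` of the noise `U`. The true
design augmented by it fits `Y` with error at most `σ₀‖U‖ε`. A competitor `Π` can do as well only by
using a nonzero multiple of `e` to bridge the gap between the true mean `μ` and the range of `ΠX`;
this gap is positive because `C_min > 0`. Hence `e` nearly lies in a space of dimension at most `p +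
1` (`norm_starProjection_orthSpace_le`), which for `‖U‖ ≤ R` has probability of order
`(R²ε)^(n-p-1)`. No sample is close with probability at most `exp(-L(cε)^n)`, and `‖U‖ > R` is
polynomially rare. Suitable powers of `L` for `ε` and `R` give the rate even without the logarithm.
The constants depend only on the model, so `δ` serves every tie-breaking rule. -/

noncomputable section

/-! ### Orthogonal splitting and polar decomposition of Gaussian vectors -/

section GaussianGeometry

variable {E : Type*} [NormedAddCommGroup E] [InnerProductSpace ℝ E] [FiniteDimensional ℝ E]
  [MeasurableSpace E] [BorelSpace E]

/-- A standard Gaussian vector is the sum of independent standard Gaussian vectors of a subspace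
and of its orthogonal complement. -/
lemma stdGaussian_eq_map_add (K : Submodule ℝ E) :
    stdGaussian E =
      ((stdGaussian K).prod (stdGaussian Kᗮ)).map (fun z => (z.1 : E) + (z.2 : E)) := by
  have : ((stdGaussian K).prod (stdGaussian Kᗮ)).map (fun z => (z.1 : E) + (z.2 : E)) =
      ((stdGaussian K).map (fun x : K => (x : E))) ∗ ((stdGaussian Kᗮ).map (fun x : Kᗮ => (x : E))) := by
    rw [Measure.conv, Measure.map_prod_map _ _ (by fun_prop) (by fun_prop),
      Measure.map_map (by fun_prop) (by fun_prop)]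
    rfl
  -- Pairing with a vector of `V` sees only the projection of `t`. By Pythagoras the exponents for
  -- `K` and `Kᗮ` add up to that of the whole space.
  have key (V : Submodule ℝ E) (t : E) :
      charFun ((stdGaussian V).map (fun x : V => (x : E))) t
        = Complex.exp (-‖V.orthogonalProjectionOnto t‖ ^ 2 / 2) := by
    rw [← charFun_stdGaussian, charFun_apply, charFun_apply,
      integral_map (by fun_prop) (by fun_prop)]
    refine integral_congr_ae (Eventually.of_forall fun x => ?_)
    simp only
    rw [V.inner_orthogonalProjectionOnto_eq_of_mem_left]
  rw [this]
  have : IsProbabilityMeasure ((stdGaussian K).map (fun x : K => (x : E))) :=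
    Measure.isProbabilityMeasure_map (by fun_prop)
  have : IsProbabilityMeasure ((stdGaussian Kᗮ).map (fun x : Kᗮ => (x : E))) :=
    Measure.isProbabilityMeasure_map (by fun_prop)
  apply Measure.ext_of_charFun
  ext t
  rw [charFun_conv, key, key, charFun_stdGaussian, ← Complex.exp_add]
  congr 1
  have := Submodule.norm_sq_eq_add_norm_sq_projection t K
  have h2 : ((‖t‖ : ℝ) : ℂ) ^ 2 = ((‖K.orthogonalProjectionOnto t‖ ^ 2 + ‖Kᗮ.orthogonalProjectionOnto t‖ ^ 2 : ℝ) : ℂ) := by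
    rw [← this]; push_cast; rfl
  rw [h2]; push_cast; ring

lemma stdGaussian_map_orthogonalProjection (K : Submodule ℝ E) :
    (stdGaussian E).map K.orthogonalProjectionOnto = stdGaussian K := by
  rw [stdGaussian_eq_map_add K, Measure.map_map (by fun_prop) (by fun_prop)]
  have : (K.orthogonalProjectionOnto ∘ fun z : K × Kᗮ => (z.1 : E) + (z.2 : E)) = Prod.fst := by
    ext z
    simp [Submodule.starProjection_apply_eq_zero_iff]
  rw [this]
  simp

/-- The complex Gaussian integral shows that both sides have the same characteristic function. The
constant can stay unspecified: polar coordinates absorb it into the radial measure. -/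
lemma stdGaussian_eq_withDensity :
    ∃ c : ENNReal, stdGaussian E =
      c • (volume : Measure E).withDensity (fun x => ENNReal.ofReal (Real.exp (-‖x‖ ^ 2 / 2))) := by
  set w : E → ℝ := fun x => Real.exp (-‖x‖ ^ 2 / 2) with hw
  have hI : ∫ x : E, w x = (2 * Real.pi) ^ (Module.finrank ℝ E / 2 : ℝ) := by
    have := GaussianFourier.integral_rexp_neg_mul_sq_norm (V := E) (b := 1 / 2) (by norm_num)
    rw [show 2 * Real.pi = Real.pi / (1 / 2) by ring, ← this]
    refine integral_congr_ae (Eventually.of_forall fun x => ?_)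
    simp only [hw]
    congr 1; ring
  have hpos : 0 < ∫ x : E, w x := by rw [hI]; positivity
  have hint : Integrable w := by
    by_contra h
    rw [integral_undef h] at hpos
    exact lt_irrefl _ hpos
  set I := ∫ x : E, w x with hIdef
  have hwm : Measurable fun x : E => ENNReal.ofReal (w x) := by fun_prop
  have hmass : ((volume : Measure E).withDensity (fun x => ENNReal.ofReal (w x))) Set.univ
      = ENNReal.ofReal I := by
    rw [withDensity_apply _ MeasurableSet.univ, Measure.restrict_univ,
      ← ofReal_integral_eq_lintegral_ofReal hint (Eventually.of_forall fun x => (Real.exp_pos _).le)]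
  have hfin : IsFiniteMeasure ((volume : Measure E).withDensity (fun x => ENNReal.ofReal (w x))) :=
    ⟨by rw [hmass]; exact ENNReal.ofReal_lt_top⟩
  refine ⟨ENNReal.ofReal I⁻¹, ?_⟩
  have hfin2 : IsFiniteMeasure (ENNReal.ofReal I⁻¹ •
      (volume : Measure E).withDensity (fun x => ENNReal.ofReal (w x))) :=
    Measure.smul_finite _ ENNReal.ofReal_ne_top
  apply Measure.ext_of_charFun
  ext t
  rw [charFun_stdGaussian, charFun_apply, integral_smul_measure,
    integral_withDensity_eq_integral_toReal_smul hwm (by simp)]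
  have h1 := GaussianFourier.integral_cexp_neg_mul_sq_norm_add (V := E) (b := (1 / 2 : ℂ))
    (by norm_num) Complex.I t
  have h0 := GaussianFourier.integral_cexp_neg_mul_sq_norm_add (V := E) (b := (1 / 2 : ℂ))
    (by norm_num) 0 t
  have hIc : (I : ℂ) = (Real.pi / (1 / 2 : ℂ)) ^ (Module.finrank ℝ E / 2 : ℂ) := by
    rw [hIdef, ← integral_complex_ofReal]
    simp only [hw, zero_mul, add_zero] at h0 ⊢
    rw [show (0:ℂ) ^ 2 * (‖t‖:ℂ) ^ 2 / (4 * (1 / 2)) = 0 by simp, Complex.exp_zero, mul_one] at h0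
    rw [← h0]
    congr 1; ext x; push_cast; congr 1; ring
  have h2 : ∫ x : E, (ENNReal.ofReal (w x)).toReal • Complex.exp (inner ℝ x t * Complex.I)
      = I * Complex.exp (-‖t‖ ^ 2 / 2) := by
    rw [hIc]
    have : Complex.I ^ 2 * (‖t‖ : ℂ) ^ 2 / (4 * (1 / 2)) = -‖t‖ ^ 2 / 2 := by
      rw [Complex.I_sq]; ring
    rw [this] at h1
    rw [← h1]
    congr 1; ext x
    rw [ENNReal.toReal_ofReal (Real.exp_pos _).le, Complex.real_smul]
    push_cast
    rw [← Complex.exp_add, real_inner_comm]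
    congr 1; ring
  rw [h2, ENNReal.toReal_ofReal (by positivity), Complex.real_smul, ← mul_assoc]
  have : ((I⁻¹ : ℝ) : ℂ) * I = 1 := by
    rw [← Complex.ofReal_mul, inv_mul_cancel₀ hpos.ne']; simp
  rw [this, one_mul]

/-- Integration against a standard Gaussian measure in polar coordinates. -/
lemma lintegral_stdGaussian_polar (E : Type*) [NormedAddCommGroup E] [InnerProductSpace ℝ E]
    [FiniteDimensional ℝ E] [MeasurableSpace E] [BorelSpace E] [Nontrivial E] :
    ∃ (μ : Measure (Metric.sphere (0 : E) 1)) (ν : Measure (Set.Ioi (0 : ℝ))),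
      SFinite μ ∧ SFinite ν ∧ ∀ g : E → ENNReal, Measurable g →
        ∫⁻ x, g x ∂(stdGaussian E) = ∫⁻ r, ∫⁻ θ, g (r.1 • θ.1) ∂μ ∂ν := by
  obtain ⟨c, hc⟩ := stdGaussian_eq_withDensity (E := E)
  set w : ℝ → ENNReal := fun r => ENNReal.ofReal (Real.exp (-r ^ 2 / 2)) with hw
  have hwm : Measurable w := by fun_prop
  set ρ := Measure.volumeIoiPow (Module.finrank ℝ E - 1) with hρ
  -- The density depends only on the norm, so it is carried by the radial factor alone.
  refine ⟨(volume : Measure E).toSphere, c • ρ.withDensity (fun r => w r.1), inferInstance,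
    inferInstance, fun g hg => ?_⟩
  rw [hc, lintegral_smul_measure, lintegral_smul_measure,
    lintegral_withDensity_eq_lintegral_mul _ (by fun_prop) hg,
    lintegral_withDensity_eq_lintegral_mul _ (by fun_prop)
      (Measurable.lintegral_prod_right (by fun_prop))]
  congr 1
  have hMP := (volume : Measure E).measurePreserving_homeomorphUnitSphereProd
  have h1 : ∫⁻ x : E, w ‖x‖ * g x
      = ∫⁻ x : ({0}ᶜ : Set E), w ‖x.1‖ * g x.1 ∂(volume.comap Subtype.val) := by
    rw [lintegral_subtype_comap (measurableSet_singleton (0:E)).compl (fun x : E => w ‖x‖ * g x),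
      restrict_compl_singleton]
  have h2 : ∫⁻ x : ({0}ᶜ : Set E), w ‖x.1‖ * g x.1 ∂(volume.comap Subtype.val)
      = ∫⁻ p, w p.2.1 * g (p.2.1 • p.1.1) ∂((volume : Measure E).toSphere.prod ρ) := by
    rw [← hMP.lintegral_comp (by fun_prop)]
    refine lintegral_congr fun x => ?_
    have hx : ‖x.1‖ ≠ 0 := norm_ne_zero_iff.2 x.2
    simp [smul_smul, hx]
  refine h1.trans (h2.trans ?_)
  rw [lintegral_prod_symm' _ (by fun_prop)]
  refine lintegral_congr fun r => ?_
  exact lintegral_const_mul (w r.1) (f := fun θ : Metric.sphere (0 : E) 1 => g (r.1 • θ.1))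
    (by fun_prop)

/-- The direction of a standard Gaussian vector is independent of its norm: replacing it by the
direction of an independent copy does not change the law. -/
lemma lintegral_stdGaussian_norm_direction [Nontrivial E] (g : ℝ → E → ENNReal) (hg : Measurable (Function.uncurry g)) :
    ∫⁻ x, g ‖x‖ x ∂(stdGaussian E)
      = ∫⁻ x, ∫⁻ y, g ‖x‖ ((‖x‖ / ‖y‖) • y) ∂(stdGaussian E) ∂(stdGaussian E) := by
  obtain ⟨μ, ν, _, _, h⟩ := lintegral_stdGaussian_polar E
  have hn (r : Set.Ioi (0:ℝ)) (θ : Metric.sphere (0 : E) 1) : ‖r.1 • θ.1‖ = r.1 := by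
    have := r.2.out
    simp [norm_smul, abs_of_pos this]
  have hm : Measurable fun z : E × E => g ‖z.1‖ ((‖z.1‖ / ‖z.2‖) • z.2) :=
    hg.comp
      (by fun_prop : Measurable fun z : E × E => (‖z.1‖, (‖z.1‖ / ‖z.2‖) • z.2))
  -- Neither polar factor is normalised; only the product of their masses is known, from integrating
  -- the constant 1.
  have hone : ν Set.univ * μ Set.univ = 1 := by
    have := h (fun _ => 1) measurable_const
    simpa [mul_comm] using this.symm
  have hm' (r : ℝ) : Measurable (g r) := hg.comp (by fun_prop : Measurable fun x : E => (r, x))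
  have hd : Measurable fun x : E => g ‖x‖ x :=
    hg.comp (by fun_prop : Measurable fun x : E => (‖x‖, x))
  rw [h _ hd,
    h _ (Measurable.lintegral_prod_right hm)]
  have inner (r : Set.Ioi (0:ℝ)) (θ : Metric.sphere (0 : E) 1) :
      ∫⁻ y, g ‖r.1 • θ.1‖ ((‖r.1 • θ.1‖ / ‖y‖) • y) ∂(stdGaussian E)
        = ν Set.univ * ∫⁻ θ', g r.1 (r.1 • θ'.1) ∂μ := by
    rw [h _ (by rw [hn]; exact (hm' _).comp (by fun_prop))]
    have : ∀ (r' : Set.Ioi (0:ℝ)) (θ' : Metric.sphere (0 : E) 1),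
        g ‖r.1 • θ.1‖ ((‖r.1 • θ.1‖ / ‖r'.1 • θ'.1‖) • r'.1 • θ'.1) = g r.1 (r.1 • θ'.1) := by
      intro r' θ'
      have := r'.2.out.ne'
      rw [hn, hn, smul_smul, div_mul_cancel₀ _ this]
    simp_rw [this]
    rw [lintegral_const, mul_comm]
  simp_rw [inner, hn, lintegral_const]
  refine lintegral_congr fun r => ?_
  rw [mul_right_comm, hone, one_mul]

end GaussianGeometry

/-! ### Sufficiency and the conditional law of the data -/

section ConditionalLaw

variable {n p : ℕ}

/-- The column space of `Π X`. -/
abbrev designRange (X : Matrix (Fin n) (Fin p) ℝ) (π : Equiv.Perm (Fin n)) :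
    Submodule ℝ (Vec n) :=
  LinearMap.range (Matrix.toEuclideanLin (permDesign X π))

lemma rangeProj_permDesign (X : Matrix (Fin n) (Fin p) ℝ) (π : Equiv.Perm (Fin n)) :
    rangeProj (permDesign X π) = (designRange X π).starProjection := rfl

lemma resid_permDesign (X : Matrix (Fin n) (Fin p) ℝ) (π : Equiv.Perm (Fin n)) (y : Vec n) :
    resid (permDesign X π) y = (designRange X π)ᗮ.starProjection y := by
  rw [resid, rangeProj_permDesign, Submodule.starProjection_orthogonal_val]

lemma meanVec_eq (X : Matrix (Fin n) (Fin p) ℝ) (π : Equiv.Perm (Fin n)) (β : Fin p → ℝ) :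
    meanVec X π β = Matrix.toEuclideanLin (permDesign X π) (WithLp.toLp 2 β) := by
  simp [meanVec]

lemma meanVec_mem (X : Matrix (Fin n) (Fin p) ℝ) (π : Equiv.Perm (Fin n)) (β : Fin p → ℝ) :
    meanVec X π β ∈ designRange X π := ⟨_, (meanVec_eq X π β).symm⟩

lemma finrank_designRange_le (X : Matrix (Fin n) (Fin p) ℝ) (π : Equiv.Perm (Fin n)) :
    Module.finrank ℝ (designRange X π) ≤ p := by
  simpa using LinearMap.finrank_range_le (Matrix.toEuclideanLin (permDesign X π))

lemma le_finrank_designRange_orthogonal (X : Matrix (Fin n) (Fin p) ℝ)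
    (π : Equiv.Perm (Fin n)) : n - p ≤ Module.finrank ℝ (designRange X π)ᗮ := by
  have h1 := (designRange X π).finrank_add_finrank_orthogonal
  have h2 := finrank_designRange_le X π
  rw [finrank_euclideanSpace_fin] at h1
  omega

@[fun_prop]
lemma measurable_suffStat (X : Matrix (Fin n) (Fin p) ℝ) (π : Equiv.Perm (Fin n)) :
    Measurable (suffStat X π) := by
  unfold suffStat resid
  fun_prop

@[fun_prop]
lemma measurable_response (X : Matrix (Fin n) (Fin p) ℝ) (π : Equiv.Perm (Fin n))
    (β : Fin p → ℝ) (σ : ℝ) : Measurable (response X π β σ) := by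
  unfold response
  fun_prop

lemma measurable_condLaw_map (X : Matrix (Fin n) (Fin p) ℝ) (π : Equiv.Perm (Fin n)) :
    Measurable fun z : (Vec n × ℝ) × Vec n =>
      z.1.1 + (z.1.2 / ‖resid (permDesign X π) z.2‖) • resid (permDesign X π) z.2 := by
  unfold resid
  fun_prop

/-- The conditional laws `condLaw` as a Markov kernel. -/
def condKernel (X : Matrix (Fin n) (Fin p) ℝ) (π : Equiv.Perm (Fin n)) :
    Kernel (Vec n × ℝ) (Vec n) :=
  (Kernel.id ×ₖ Kernel.const _ (stdGaussian (Vec n))).map fun z =>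
    z.1.1 + (z.1.2 / ‖resid (permDesign X π) z.2‖) • resid (permDesign X π) z.2

lemma condKernel_apply (X : Matrix (Fin n) (Fin p) ℝ) (π : Equiv.Perm (Fin n))
    (s : Vec n × ℝ) : condKernel X π s = condLaw X π s := by
  rw [condKernel, Kernel.map_apply _ (measurable_condLaw_map X π), Kernel.prod_apply,
    Kernel.id_apply, Kernel.const_apply, Measure.dirac_prod,
    Measure.map_map (measurable_condLaw_map X π) (by fun_prop)]
  rfl

instance (X : Matrix (Fin n) (Fin p) ℝ) (π : Equiv.Perm (Fin n)) :
    IsMarkovKernel (condKernel X π) :=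
  Kernel.IsMarkovKernel.map _ (measurable_condLaw_map X π)

lemma lintegral_stdGaussian_decomp {E : Type*} [NormedAddCommGroup E] [InnerProductSpace ℝ E]
    [FiniteDimensional ℝ E] [MeasurableSpace E] [BorelSpace E] (K : Submodule ℝ E)
    {f : E → ENNReal} (hf : Measurable f) :
    ∫⁻ u, f u ∂(stdGaussian E)
      = ∫⁻ x : K, ∫⁻ y : Kᗮ, f ((x : E) + (y : E)) ∂(stdGaussian Kᗮ) ∂(stdGaussian K) := by
  rw [stdGaussian_eq_map_add K, lintegral_map hf (by fun_prop), lintegral_prod _ (by fun_prop)]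

lemma lintegral_condLaw (X : Matrix (Fin n) (Fin p) ℝ) (π : Equiv.Perm (Fin n))
    (s : Vec n × ℝ) {f : Vec n → ENNReal} (hf : Measurable f) :
    ∫⁻ y, f y ∂(condLaw X π s)
      = ∫⁻ y : (designRange X π)ᗮ, f (s.1 + (s.2 / ‖y‖) • (y : Vec n))
          ∂(stdGaussian (designRange X π)ᗮ) := by
  have hm : Measurable fun U : Vec n =>
      s.1 + (s.2 / ‖resid (permDesign X π) U‖) • resid (permDesign X π) U :=
    (measurable_condLaw_map X π).comp (measurable_prodMk_left (x := s))
  have h := stdGaussian_map_orthogonalProjection (designRange X π)ᗮ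
  rw [condLaw, lintegral_map hf hm, ← h, lintegral_map (by fun_prop) (by fun_prop)]
  simp only [resid_permDesign]
  rfl

/-- Sufficiency: the joint law of the statistic and the data is the law of the statistic
composed with the kernel `condLaw`. -/
lemma map_suffStat_response (hnp : p < n) (X : Matrix (Fin n) (Fin p) ℝ)
    (π : Equiv.Perm (Fin n)) (β : Fin p → ℝ) {σ : ℝ} (hσ : 0 < σ) :
    (stdGaussian (Vec n)).map
        (fun U => (suffStat X π (response X π β σ U), response X π β σ U))
      = ((stdGaussian (Vec n)).map fun U => suffStat X π (response X π β σ U))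
          ⊗ₘ condKernel X π := by
  -- A direction in the complement exists only if the complement is nonzero; this is where `p < n`
  -- enters.
  have hnt : Nontrivial (designRange X π)ᗮ := by
    have := le_finrank_designRange_orthogonal X π
    have : 0 < n - p := by omega
    exact Module.nontrivial_of_finrank_pos (R := ℝ) (this.trans_le ‹_›)
  set m := meanVec X π β
  have hmK : m ∈ (designRange X π) := meanVec_mem X π β
  have hY : Measurable fun U => response X π β σ U := by fun_prop
  have hS : Measurable fun U => suffStat X π (response X π β σ U) := by fun_prop
  have hstat (x : (designRange X π)) (y : (designRange X π)ᗮ) :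
      suffStat X π (response X π β σ ((x : Vec n) + (y : Vec n)))
        = (m + σ • (x : Vec n), σ * ‖y‖) := by
    have hx : m + σ • (x : Vec n) ∈ (designRange X π) := (designRange X π).add_mem hmK ((designRange X π).smul_mem _ x.2)
    have hy : σ • (y : Vec n) ∈ (designRange X π)ᗮ := (designRange X π)ᗮ.smul_mem _ y.2
    have e : response X π β σ ((x : Vec n) + (y : Vec n))
        = (m + σ • (x : Vec n)) + σ • (y : Vec n) := by
      rw [response, smul_add, add_assoc]
    have h1 : (designRange X π).starProjection ((m + σ • (x : Vec n)) + σ • (y : Vec n))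
        = m + σ • (x : Vec n) := by
      rw [map_add, Submodule.starProjection_eq_self_iff.2 hx,
        ((designRange X π).starProjection_apply_eq_zero_iff).2 hy, add_zero]
    rw [e, suffStat, resid, rangeProj_permDesign, h1, add_sub_cancel_left, norm_smul,
      Real.norm_of_nonneg hσ.le]
    rfl
  refine Measure.ext_of_lintegral _ fun f hf => ?_
  have hL : Measurable fun a => ∫⁻ b, f (a, b) ∂(condKernel X π a) :=
    Measurable.lintegral_kernel_prod_right' hf
  rw [lintegral_map hf (hS.prodMk hY), Measure.lintegral_compProd hf,
    lintegral_map hL hS,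
    lintegral_stdGaussian_decomp (designRange X π) (by fun_prop),
    lintegral_stdGaussian_decomp (designRange X π)
      (f := fun U => ∫⁻ b, f (suffStat X π (response X π β σ U), b)
        ∂(condKernel X π (suffStat X π (response X π β σ U)))) (hL.comp hS)]
  refine lintegral_congr fun x => ?_
  -- With the component `x` in the column space frozen, the integrand depends on the complementary
  -- part through its norm `r` (the statistic) and the vector itself (the data), which is the form
  -- the norm-direction lemma handles.
  have hg : Measurable (Function.uncurry fun (r : ℝ) (v : (designRange X π)ᗮ) =>
      f ((m + σ • (x : Vec n), σ * r), m + σ • (x : Vec n) + σ • (v : Vec n))) := by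
    refine hf.comp ?_
    fun_prop
  have := lintegral_stdGaussian_norm_direction _ hg
  simp only [hstat]
  convert this using 1
  · refine lintegral_congr fun y => ?_
    rw [response, smul_add, add_assoc]
  · refine lintegral_congr fun y => ?_
    rw [condKernel_apply, lintegral_condLaw X π _ (by fun_prop)]
    refine lintegral_congr fun v => ?_
    simp only [Submodule.coe_smul, smul_smul]
    rw [mul_div_assoc]

lemma condDistrib_response (hnp : p < n) (X : Matrix (Fin n) (Fin p) ℝ)
    (π : Equiv.Perm (Fin n)) (β : Fin p → ℝ) {σ : ℝ} (hσ : 0 < σ) :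
    ∀ᵐ s ∂((stdGaussian (Vec n)).map fun U => suffStat X π (response X π β σ U)),
      condDistrib (fun U => response X π β σ U)
        (fun U => suffStat X π (response X π β σ U)) (stdGaussian (Vec n)) s
        = condLaw X π s := by
  filter_upwards [condDistrib_ae_eq_of_measure_eq_compProd
    (fun U => suffStat X π (response X π β σ U)) (by fun_prop)
    (map_suffStat_response hnp X π β hσ)] with s hs
  rw [hs, condKernel_apply]

end ConditionalLaw

/-! ### Level of the test -/

section TypeOneError

variable {n p k L : ℕ}

lemma measurableSet_mem_candidateSet {X : Matrix (Fin n) (Fin p) ℝ}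
    {sel : Vec n → Vec n → Equiv.Perm (Fin n)} (hsel : IsReproRule k X sel)
    (π : Equiv.Perm (Fin n)) :
    MeasurableSet {z : (Fin L → Vec n) × Vec n | π ∈ candidateSet sel z.1 z.2} := by
  have : {z : (Fin L → Vec n) × Vec n | π ∈ candidateSet sel z.1 z.2}
      = ⋃ l : Fin L, (fun z : (Fin L → Vec n) × Vec n => (z.2, z.1 l)) ⁻¹'
          {w : Vec n × Vec n | sel w.1 w.2 = π} := by
    ext z
    simp [candidateSet]
  rw [this]
  exact MeasurableSet.iUnion fun l => (hsel.meas π).preimage (by fun_prop)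

lemma measurableSet_candidateSet_eq {X : Matrix (Fin n) (Fin p) ℝ}
    {sel : Vec n → Vec n → Equiv.Perm (Fin n)} (hsel : IsReproRule k X sel)
    (C : Finset (Equiv.Perm (Fin n))) :
    MeasurableSet {z : (Fin L → Vec n) × Vec n | candidateSet sel z.1 z.2 = C} := by
  simp_rw [Finset.ext_iff, Set.ofPred_forall]
  refine MeasurableSet.iInter fun π => ?_
  by_cases h : π ∈ C
  · simpa only [h, iff_true] using measurableSet_mem_candidateSet hsel π
  · simp only [h, iff_false]
    exact (measurableSet_mem_candidateSet hsel π).compl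

lemma measurable_statD {X : Matrix (Fin n) (Fin p) ℝ}
    {sel : Vec n → Vec n → Equiv.Perm (Fin n)} (hsel : IsReproRule k X sel)
    {ls : Finset (Equiv.Perm (Fin n)) → Vec n → Equiv.Perm (Fin n)} (hls : IsLSRule X ls) :
    Measurable fun z : (Fin L → Vec n) × Vec n => statD sel ls z.1 z.2 := by
  refine measurable_to_countable' fun d => ?_
  have : (fun z : (Fin L → Vec n) × Vec n => statD sel ls z.1 z.2) ⁻¹' {d}
      = ⋃ (C : Finset (Equiv.Perm (Fin n))) (π : Equiv.Perm (Fin n)) (_ : permDist π = d),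
          {z | candidateSet sel z.1 z.2 = C} ∩ Prod.snd ⁻¹' {y | ls C y = π} := by
    ext z
    simp [statD]
  rw [this]
  exact MeasurableSet.iUnion fun C => MeasurableSet.iUnion fun π => MeasurableSet.iUnion fun _ =>
    (measurableSet_candidateSet_eq hsel C).inter ((hls.meas C π).preimage measurable_snd)

lemma permDist_le (π : Equiv.Perm (Fin n)) : permDist π ≤ n := by
  simpa [permDist] using Finset.card_filter_le (Finset.univ : Finset (Fin n)) _

/-- Boundedness of `T` makes the set of admissible levels nonempty, so the infimum is attained and
is not the default value 0 of `sInf ∅`. -/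
lemma ofReal_le_measure_natQuantile {μ : Measure (Vec n)} [IsProbabilityMeasure μ]
    {T : Vec n → ℕ} {N : ℕ} (hT : ∀ y, T y ≤ N) {q : ℝ} (hq : q ≤ 1) :
    ENNReal.ofReal q ≤ μ {y | T y ≤ natQuantile μ T q} := by
  refine Nat.sInf_mem (s := {c : ℕ | ENNReal.ofReal q ≤ μ {y | T y ≤ c}}) ⟨N, ?_⟩
  simp [hT, hq]

/-- Under its own law, a statistic exceeds a level whose distribution function is at least
`1 - α` with probability at most `α`. -/
lemma measure_exceeds_quantile_le {Ω : Type*} [MeasurableSpace Ω] (μ : Measure Ω)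
    [IsProbabilityMeasure μ] {T : Ω → ℕ} (hT : Measurable T) (α : ℝ) :
    μ {y | ∃ c < T y, ENNReal.ofReal (1 - α) ≤ μ {y | T y ≤ c}} ≤ ENNReal.ofReal α := by
  by_cases h : ∃ c, ENNReal.ofReal (1 - α) ≤ μ {y | T y ≤ c}
  · classical
    have hsub : {y | ∃ c < T y, ENNReal.ofReal (1 - α) ≤ μ {y | T y ≤ c}}
        ⊆ {y | T y ≤ Nat.find h}ᶜ := by
      rintro y ⟨c, hc, hcα⟩
      simpa using (Nat.find_min' h hcα).trans_lt hc
    refine (measure_mono hsub).trans ?_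
    rw [prob_compl_eq_one_sub (s := {y | T y ≤ Nat.find h}) (hT measurableSet_Iic), tsub_le_iff_right]
    calc (1 : ENNReal) = ENNReal.ofReal (α + (1 - α)) := by simp
      _ ≤ ENNReal.ofReal α + ENNReal.ofReal (1 - α) := ENNReal.ofReal_add_le
      _ ≤ _ := by gcongr; exact Nat.find_spec h
  · have : {y | ∃ c < T y, ENNReal.ofReal (1 - α) ≤ μ {y | T y ≤ c}} = ∅ := by
      ext y
      simp only [Set.mem_ofPred_eq, Set.mem_empty_iff_false, iff_false]
      rintro ⟨c, -, hc⟩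
      exact h ⟨c, hc⟩
    simp [this]

/-- For a measurable statistic, the test calibrated by the conditional law given the sufficient
statistic has level `α`. -/
lemma measure_exceeds_condQuantile_le (hnp : p < n) (X : Matrix (Fin n) (Fin p) ℝ)
    (π : Equiv.Perm (Fin n)) (β : Fin p → ℝ) {σ : ℝ} (hσ : 0 < σ) {T : Vec n → ℕ}
    (hT : Measurable T) (α : ℝ) :
    stdGaussian (Vec n) {U | ∃ c < T (response X π β σ U), ENNReal.ofReal (1 - α) ≤
        condKernel X π (suffStat X π (response X π β σ U)) {y | T y ≤ c}} ≤ ENNReal.ofReal α := by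
  set A : Set ((Vec n × ℝ) × Vec n) :=
    {z | ∃ c < T z.2, ENNReal.ofReal (1 - α) ≤ condKernel X π z.1 {y | T y ≤ c}} with hA
  have hAm : MeasurableSet A := by
    have : A = ⋃ c : ℕ, {z | c < T z.2} ∩
        {z | ENNReal.ofReal (1 - α) ≤ condKernel X π z.1 {y | T y ≤ c}} := by
      ext z
      simp [hA]
    rw [this]
    refine MeasurableSet.iUnion fun c => ?_
    refine ((hT.comp measurable_snd) measurableSet_Ioi).inter ?_
    exact measurableSet_le measurable_const
      (((condKernel X π).measurable_coe (hT measurableSet_Iic)).comp measurable_fst)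
  calc _ = (stdGaussian (Vec n)).map
        (fun U => (suffStat X π (response X π β σ U), response X π β σ U)) A := by
        rw [Measure.map_apply (by fun_prop) hAm]; rfl
    _ = ∫⁻ s, condKernel X π s (Prod.mk s ⁻¹' A)
          ∂((stdGaussian (Vec n)).map fun U => suffStat X π (response X π β σ U)) := by
        rw [map_suffStat_response hnp X π β hσ, Measure.compProd_apply hAm]
    _ ≤ ∫⁻ s, ENNReal.ofReal α
          ∂((stdGaussian (Vec n)).map fun U => suffStat X π (response X π β σ U)) :=
        lintegral_mono fun s => measure_exceeds_quantile_le (condKernel X π s) hT α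
    _ = ENNReal.ofReal α := by
        rw [lintegral_const, Measure.map_apply (by fun_prop) MeasurableSet.univ]
        simp

/-- The repro samples are independent of the noise: by Fubini they can be frozen, and `D` becomes a
fixed measurable statistic of the data. -/
lemma jointLaw_exceeds_critVal_le (hnp : p < n) {X : Matrix (Fin n) (Fin p) ℝ}
    (π₀ : Equiv.Perm (Fin n)) (β₀ : Fin p → ℝ) {σ₀ : ℝ} (hσ₀ : 0 < σ₀)
    {sel : Vec n → Vec n → Equiv.Perm (Fin n)} (hsel : IsReproRule k X sel)
    {ls : Finset (Equiv.Perm (Fin n)) → Vec n → Equiv.Perm (Fin n)} (hls : IsLSRule X ls)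
    {α : ℝ} (hα : 0 ≤ α) :
    jointLaw n L {ω | critVal X sel ls α ω.1 (response X π₀ β₀ σ₀ ω.2) π₀
        < statD sel ls ω.1 (response X π₀ β₀ σ₀ ω.2)} ≤ ENNReal.ofReal α := by
  have hD := measurable_statD (L := L) hsel hls
  -- A measurable superset of the event: some level below `D` already has conditional probability at
  -- least `1 - α`. This avoids proving that the critical value is measurable.
  set B : Set ((Fin L → Vec n) × Vec n) :=
    {ω | ∃ c < statD sel ls ω.1 (response X π₀ β₀ σ₀ ω.2), ENNReal.ofReal (1 - α) ≤
      condKernel X π₀ (suffStat X π₀ (response X π₀ β₀ σ₀ ω.2)) {y | statD sel ls ω.1 y ≤ c}}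
    with hB
  have hBm : MeasurableSet B := by
    have : B = ⋃ c : ℕ, {ω | c < statD sel ls ω.1 (response X π₀ β₀ σ₀ ω.2)} ∩
        {ω | ENNReal.ofReal (1 - α) ≤ condKernel X π₀
          (suffStat X π₀ (response X π₀ β₀ σ₀ ω.2)) {y | statD sel ls ω.1 y ≤ c}} := by
      ext z
      simp [hB]
    rw [this]
    refine MeasurableSet.iUnion fun c => MeasurableSet.inter ?_ ?_
    · exact (hD.comp (by fun_prop : Measurable fun ω : (Fin L → Vec n) × Vec n =>
        (ω.1, response X π₀ β₀ σ₀ ω.2))) measurableSet_Ioi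
    · refine measurableSet_le measurable_const ?_
      have hS : Measurable fun ω : (Fin L → Vec n) × Vec n =>
        suffStat X π₀ (response X π₀ β₀ σ₀ ω.2) := by fun_prop
      have ht : MeasurableSet {z : ((Fin L → Vec n) × Vec n) × Vec n |
          statD sel ls z.1.1 z.2 ≤ c} :=
        (hD.comp (by fun_prop : Measurable fun z : ((Fin L → Vec n) × Vec n) × Vec n =>
          (z.1.1, z.2))) measurableSet_Iic
      exact Kernel.measurable_kernel_prodMk_left (κ := (condKernel X π₀).comap _ hS) ht
  have hsub : {ω : (Fin L → Vec n) × Vec n |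
      critVal X sel ls α ω.1 (response X π₀ β₀ σ₀ ω.2) π₀
        < statD sel ls ω.1 (response X π₀ β₀ σ₀ ω.2)} ⊆ B := by
    intro ω hω
    refine ⟨_, hω, ?_⟩
    have : IsProbabilityMeasure (condLaw X π₀ (suffStat X π₀ (response X π₀ β₀ σ₀ ω.2))) := by
      rw [← condKernel_apply]; infer_instance
    rw [condKernel_apply]
    exact ofReal_le_measure_natQuantile (fun y => permDist_le _) (by linarith)
  refine (measure_mono hsub).trans ?_
  rw [jointLaw, Measure.prod_apply hBm]
  calc _ ≤ ∫⁻ _ : Fin L → Vec n, ENNReal.ofReal α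
          ∂(Measure.pi fun _ : Fin L => stdGaussian (Vec n)) :=
        lintegral_mono fun u => measure_exceeds_condQuantile_le hnp X π₀ β₀ hσ₀
          (hD.comp measurable_prodMk_left) α
    _ = ENNReal.ofReal α := by simp

lemma jointLaw_reject_le (hnp : p < n) {X : Matrix (Fin n) (Fin p) ℝ}
    {π₀ : Equiv.Perm (Fin n)} {β₀ : Fin p → ℝ} {σ₀ : ℝ} (hσ₀ : 0 < σ₀)
    {sel : Vec n → Vec n → Equiv.Perm (Fin n)} (hsel : IsReproRule k X sel)
    {ls : Finset (Equiv.Perm (Fin n)) → Vec n → Equiv.Perm (Fin n)} (hls : IsLSRule X ls)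
    {δ : ℕ → ℝ} (hδ : IsMiscoverageBound X π₀ β₀ σ₀ sel δ) {k₀ : ℕ}
    (hπ₀ : π₀ ∈ sparsePerms n k₀) {α : ℝ} (hα : 0 ≤ α) (hL : 2 ≤ L) :
    jointLaw n L {ω | statD sel ls ω.1 (response X π₀ β₀ σ₀ ω.2) ∉
        acceptSet k₀ X sel ls α ω.1 (response X π₀ β₀ σ₀ ω.2)}
      ≤ ENNReal.ofReal (α + δ L) := by
  have hsub : {ω : (Fin L → Vec n) × Vec n | statD sel ls ω.1 (response X π₀ β₀ σ₀ ω.2) ∉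
        acceptSet k₀ X sel ls α ω.1 (response X π₀ β₀ σ₀ ω.2)} ⊆
      {ω | critVal X sel ls α ω.1 (response X π₀ β₀ σ₀ ω.2) π₀
        < statD sel ls ω.1 (response X π₀ β₀ σ₀ ω.2)} ∪
      {ω | π₀ ∉ candidateSet sel ω.1 (response X π₀ β₀ σ₀ ω.2)} := by
    intro ω hω
    by_contra h
    simp only [Set.mem_union, Set.mem_ofPred_eq, not_or, not_lt, not_not] at h
    refine hω ((WithBot.coe_le_coe.2 h.1).trans ?_)
    exact Finset.le_sup (f := fun π =>
      (critVal X sel ls α ω.1 (response X π₀ β₀ σ₀ ω.2) π : WithBot ℕ))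
      (Finset.mem_inter.2 ⟨h.2, hπ₀⟩)
  refine (measure_mono hsub).trans ((measure_union_le _ _).trans ?_)
  rw [ENNReal.ofReal_add hα (hδ.pos L).le]
  exact add_le_add (jointLaw_exceeds_critVal_le hnp π₀ β₀ hσ₀ hsel hls hα) (hδ.coverage L hL)

end TypeOneError

/-! ### Small-ball and tail estimates -/

section GaussianEstimates

lemma gaussianReal_Icc_neg_self_le (ρ : ℝ) :
    gaussianReal 0 1 (Set.Icc (-ρ) ρ) ≤ ENNReal.ofReal (2 * ρ) := by
  have hpdf (x : ℝ) : gaussianPDF 0 1 x ≤ 1 := by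
    rw [gaussianPDF, ENNReal.ofReal_le_one, gaussianPDFReal]
    refine mul_le_one₀ (inv_le_one_of_one_le₀ ?_) (Real.exp_pos _).le ?_
    · rw [Real.one_le_sqrt]
      have := Real.pi_gt_three
      norm_num
      linarith
    · rw [Real.exp_le_one_iff, neg_div, neg_nonpos]
      positivity
  rw [gaussianReal_apply 0 one_ne_zero]
  calc _ ≤ ∫⁻ _ in Set.Icc (-ρ) ρ, (1 : ENNReal) := lintegral_mono hpdf
    _ = ENNReal.ofReal (2 * ρ) := by
      rw [setLIntegral_one, Real.volume_Icc]
      congr 1; ring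

/-- The interval stays inside `[-2, 2]`, where the density is at least its value at 2. -/
lemma le_gaussianReal_Icc {a h : ℝ} (ha : |a| ≤ 1) (hh : h ≤ 1) :
    ENNReal.ofReal (gaussianPDFReal 0 1 2 * (2 * h)) ≤ gaussianReal 0 1 (Set.Icc (a - h) (a + h)) := by
  have hpdf : ∀ x ∈ Set.Icc (a - h) (a + h),
      ENNReal.ofReal (gaussianPDFReal 0 1 2) ≤ gaussianPDF 0 1 x := by
    intro x hx
    obtain ⟨h1, h2⟩ := abs_le.1 ha
    have hx2 : x ^ 2 ≤ 2 ^ 2 := sq_le_sq.2 (by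
      rw [abs_two]; exact abs_le.2 ⟨by linarith [hx.1], by linarith [hx.2]⟩)
    refine ENNReal.ofReal_le_ofReal ?_
    simp only [gaussianPDFReal, sub_zero]
    gcongr
  rw [gaussianReal_apply 0 one_ne_zero]
  calc _ = ∫⁻ _ in Set.Icc (a - h) (a + h), ENNReal.ofReal (gaussianPDFReal 0 1 2) := by
        rw [setLIntegral_const, Real.volume_Icc,
          ENNReal.ofReal_mul (gaussianPDFReal_nonneg 0 1 2)]
        congr 2; ring
    _ ≤ _ := setLIntegral_mono' measurableSet_Icc hpdf

/-- A standard Gaussian vector falls in a ball of radius `ε` centred in the unit ball with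
probability at least of order `ε ^ n`. -/
lemma exists_le_stdGaussian_closedBall {n : ℕ} (hn : 0 < n) :
    ∃ c : ℝ, 0 < c ∧ ∀ (e : Vec n) (ε : ℝ), ‖e‖ ≤ 1 → 0 < ε → ε ≤ 1 →
      ENNReal.ofReal ((c * ε) ^ n) ≤ stdGaussian (Vec n) {v | ‖v - e‖ ≤ ε} := by
  have hn' : (1 : ℝ) ≤ n := by exact_mod_cast hn
  refine ⟨gaussianPDFReal 0 1 2 * (2 / n), ?_, fun e ε he hε hε1 => ?_⟩
  · have := gaussianPDFReal_pos 0 1 2 one_ne_zero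
    positivity
  -- The cube of half-side `ε / n` around `e` lies in the ball, since `n (ε/n)² ≤ ε²`. The constant
  -- `c` comes from the one-dimensional lower bound on each side.
  set h := ε / n with hh
  have hh0 : 0 < h := by positivity
  have hh1 : h ≤ 1 := (div_le_one (by positivity)).2 (hε1.trans hn')
  rw [← map_pi_eq_stdGaussian, Measure.map_apply (by fun_prop)
    (measurableSet_le (by fun_prop) measurable_const)]
  have hsub : Set.pi Set.univ (fun i : Fin n => Set.Icc (e i - h) (e i + h))
      ⊆ (WithLp.toLp 2 : (Fin n → ℝ) → Vec n) ⁻¹' {v | ‖v - e‖ ≤ ε} := by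
    intro v hv
    rw [Set.mem_preimage, Set.mem_ofPred_eq, EuclideanSpace.norm_eq]
    refine Real.sqrt_le_iff.2 ⟨hε.le, ?_⟩
    calc ∑ i, ‖(WithLp.toLp 2 v - e : Vec n) i‖ ^ 2 ≤ ∑ _i : Fin n, h ^ 2 := by
          refine Finset.sum_le_sum fun i _ => ?_
          have := hv i (Set.mem_univ i)
          refine pow_le_pow_left₀ (norm_nonneg _) ?_ 2
          rw [Real.norm_eq_abs, abs_le]
          constructor <;> simp <;> linarith [this.1, this.2]
      _ = ε ^ 2 / n := by
          simp only [Finset.sum_const, Finset.card_univ, Fintype.card_fin, nsmul_eq_mul, hh]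
          field_simp
      _ ≤ ε ^ 2 := div_le_self (by positivity) hn'
  refine le_trans ?_ (measure_mono hsub)
  rw [Measure.pi_pi]
  calc ENNReal.ofReal ((gaussianPDFReal 0 1 2 * (2 / n) * ε) ^ n)
      = ∏ _i : Fin n, ENNReal.ofReal (gaussianPDFReal 0 1 2 * (2 * h)) := by
        rw [ENNReal.ofReal_pow (by
          have := gaussianPDFReal_nonneg 0 1 2
          positivity)]
        simp only [Finset.prod_const, Finset.card_univ, Fintype.card_fin, hh]
        congr 2; ring
    _ ≤ _ := Finset.prod_le_prod' fun i _ => le_gaussianReal_Icc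
        (((PiLp.norm_apply_le e i).trans he)) hh1

/-- The norm of a standard Gaussian vector is at most `ρ` with probability at most of order
`ρ ^ dim`. -/
lemma stdGaussian_norm_le_le {F : Type*} [NormedAddCommGroup F] [InnerProductSpace ℝ F]
    [FiniteDimensional ℝ F] [MeasurableSpace F] [BorelSpace F] (ρ : ℝ) {d : ℕ}
    (hd : d ≤ Module.finrank ℝ F) :
    stdGaussian F {x | ‖x‖ ≤ ρ} ≤ ENNReal.ofReal (2 * ρ) ^ d := by
  rcases le_total 1 (ENNReal.ofReal (2 * ρ)) with h1 | h1
  · exact prob_le_one.trans (one_le_pow₀ h1)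
  -- The base is now at most 1, so it suffices to prove the bound with the full dimension as
  -- exponent.
  refine le_trans ?_ (pow_le_pow_of_le_one zero_le h1 hd)
  rw [stdGaussian, Measure.map_apply (by fun_prop)
    (measurableSet_le (by fun_prop) measurable_const)]
  have hsub : ((fun x : Fin (Module.finrank ℝ F) → ℝ =>
      ∑ i, x i • stdOrthonormalBasis ℝ F i) ⁻¹' {x | ‖x‖ ≤ ρ})
      ⊆ Set.pi Set.univ fun _ => Set.Icc (-ρ) ρ := by
    intro x hx i _
    have h : inner ℝ (stdOrthonormalBasis ℝ F i) (∑ i, x i • stdOrthonormalBasis ℝ F i) = x i := by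
      simp [inner_sum, inner_smul_right, OrthonormalBasis.inner_eq_ite]
    have h2 := abs_real_inner_le_norm (stdOrthonormalBasis ℝ F i)
      (∑ i, x i • stdOrthonormalBasis ℝ F i)
    rw [h, OrthonormalBasis.norm_eq_one, one_mul] at h2
    exact abs_le.1 (h2.trans hx)
  refine (measure_mono hsub).trans ?_
  rw [Measure.pi_pi]
  refine (Finset.prod_le_pow_card _ _ _ fun i _ => gaussianReal_Icc_neg_self_le ρ).trans ?_
  simp

lemma stdGaussian_norm_starProjection_le_le {E : Type*} [NormedAddCommGroup E]
    [InnerProductSpace ℝ E] [FiniteDimensional ℝ E] [MeasurableSpace E] [BorelSpace E]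
    (V : Submodule ℝ E) (ρ : ℝ) {d : ℕ} (hd : d ≤ Module.finrank ℝ V) :
    stdGaussian E {x | ‖V.starProjection x‖ ≤ ρ} ≤ ENNReal.ofReal (2 * ρ) ^ d := by
  refine le_trans (le_of_eq ?_) (stdGaussian_norm_le_le (F := V) ρ hd)
  rw [← stdGaussian_map_orthogonalProjection V, Measure.map_apply (by fun_prop)
    (measurableSet_le (by fun_prop) measurable_const)]
  rfl

/-- Polynomial tail bounds of every order for the norm of a standard Gaussian vector. -/
lemma exists_stdGaussian_tail_le (E : Type*) [NormedAddCommGroup E]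
    [InnerProductSpace ℝ E] [FiniteDimensional ℝ E] [MeasurableSpace E] [BorelSpace E] (q : ℕ) :
    ∃ M : ℝ, 0 ≤ M ∧ ∀ R : ℝ, 0 < R →
      stdGaussian E {x | R < ‖x‖} ≤ ENNReal.ofReal (M * (R ^ q)⁻¹) := by
  have hint : Integrable (fun x : E => ‖x‖ ^ q) (stdGaussian E) :=
    (IsGaussian.memLp_id (stdGaussian E) q (ENNReal.natCast_ne_top q)).integrable_norm_pow'
  refine ⟨∫ x, ‖x‖ ^ q ∂(stdGaussian E), integral_nonneg fun x => by positivity, fun R hR => ?_⟩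
  have h := mul_meas_ge_le_integral_of_nonneg
    (Eventually.of_forall fun x : E => by positivity) hint (R ^ q)
  have hsub : {x : E | R < ‖x‖} ⊆ {x | R ^ q ≤ ‖x‖ ^ q} := fun x hx =>
    pow_le_pow_left₀ hR.le (le_of_lt hx) q
  refine (measure_mono hsub).trans ?_
  rw [← ofReal_measureReal]
  refine ENNReal.ofReal_le_ofReal ?_
  rwa [← div_eq_mul_inv, le_div_iff₀' (by positivity)]

/-- The probability that none of `L` independent standard Gaussian vectors is `ε`-close to a
given point of the unit ball. -/
lemma pi_stdGaussian_all_far_le {n : ℕ} {c : ℝ} (hc : ∀ (e : Vec n) (ε : ℝ), ‖e‖ ≤ 1 → 0 < ε →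
    ε ≤ 1 → ENNReal.ofReal ((c * ε) ^ n) ≤ stdGaussian (Vec n) {v | ‖v - e‖ ≤ ε})
    {e : Vec n} {ε : ℝ} (he : ‖e‖ ≤ 1) (hε : 0 < ε) (hε1 : ε ≤ 1) (L : ℕ) :
    (Measure.pi fun _ : Fin L => stdGaussian (Vec n)) {u | ∀ l, ε < ‖u l - e‖}
      ≤ ENNReal.ofReal (Real.exp (-(L * (c * ε) ^ n))) := by
  have hset : {u : Fin L → Vec n | ∀ l, ε < ‖u l - e‖}
      = Set.pi Set.univ fun _ => {v | ‖v - e‖ ≤ ε}ᶜ := by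
    ext u; simp
  have hm : MeasurableSet {v : Vec n | ‖v - e‖ ≤ ε} :=
    measurableSet_le (by fun_prop) measurable_const
  have h1 : stdGaussian (Vec n) {v | ‖v - e‖ ≤ ε}ᶜ
      ≤ ENNReal.ofReal (Real.exp (-(c * ε) ^ n)) := by
    rw [prob_compl_eq_one_sub hm, tsub_le_iff_right]
    calc (1 : ENNReal) = ENNReal.ofReal 1 := by simp
      _ ≤ ENNReal.ofReal (Real.exp (-(c * ε) ^ n) + (c * ε) ^ n) := by
        refine ENNReal.ofReal_le_ofReal ?_
        linarith [Real.add_one_le_exp (-(c * ε) ^ n)]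
      _ ≤ _ := ENNReal.ofReal_add_le.trans (by gcongr; exact hc e ε he hε hε1)
  rw [hset, Measure.pi_pi, Finset.prod_const, Finset.card_univ, Fintype.card_fin]
  refine (pow_le_pow_left₀ zero_le h1 L).trans (le_of_eq ?_)
  rw [← ENNReal.ofReal_pow (Real.exp_pos _).le, ← Real.exp_nat_mul, mul_neg]

end GaussianEstimates

/-! ### What a well-fitting competitor says about the noise -/

section Separation

variable {n p k : ℕ}

/-- A vector `ΠXb` is fixed by `Π M_X Πᵀ`, which would make the separation ratio vanish. The
coverage argument uses `C_min > 0` only through this. -/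
lemma meanVec_notMem_designRange {X : Matrix (Fin n) (Fin p) ℝ} {π₀ : Equiv.Perm (Fin n)}
    {β₀ : Fin p → ℝ} (hC : 0 < Cmin k X π₀ β₀) {π : Equiv.Perm (Fin n)}
    (hπ : π ∈ (sparsePerms n k).erase π₀) : meanVec X π₀ β₀ ∉ designRange X π := by
  rintro ⟨b, hb⟩
  have hsep : 0 < separation X π₀ β₀ π :=
    EReal.coe_pos.1 (hC.trans_le (Finset.inf_le (f := fun π => (separation X π₀ β₀ π : EReal)) hπ))
  refine hsep.ne' ?_
  have hPP : (π.permMatrix ℝ).transpose * π.permMatrix ℝ = 1 := by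
    rw [Matrix.transpose_permMatrix, ← Matrix.permMatrix_mul, mul_inv_cancel,
      Matrix.permMatrix_one]
  have h1 : Matrix.toEuclideanLin (π.permMatrix ℝ).transpose (meanVec X π₀ β₀)
      = Matrix.toEuclideanLin X b := by
    rw [← hb, permDesign]
    simp only [Matrix.toLpLin_apply, Matrix.mulVec_mulVec, ← Matrix.mul_assoc, hPP,
      Matrix.one_mul]
  have h2 : rangeProj X (Matrix.toEuclideanLin X b) = Matrix.toEuclideanLin X b :=
    Submodule.starProjection_eq_self_iff.2 ⟨b, rfl⟩
  have h3 : Matrix.toEuclideanLin (π.permMatrix ℝ) (Matrix.toEuclideanLin X b)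
      = meanVec X π₀ β₀ := by
    rw [← hb, permDesign]
    simp only [Matrix.toLpLin_apply, Matrix.mulVec_mulVec]
  rw [separation, h1, h2, h3]
  simp

/-- The directions orthogonal to both the column space of `Π X` and the true mean vector. -/
abbrev orthSpace (X : Matrix (Fin n) (Fin p) ℝ) (π : Equiv.Perm (Fin n)) (μ : Vec n) :
    Submodule ℝ (Vec n) :=
  (designRange X π ⊔ Submodule.span ℝ {μ})ᗮ

lemma le_finrank_orthSpace (X : Matrix (Fin n) (Fin p) ℝ) (π : Equiv.Perm (Fin n))
    (μ : Vec n) : n - p - 1 ≤ Module.finrank ℝ (orthSpace X π μ) := by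
  have h1 := (designRange X π ⊔ Submodule.span ℝ {μ}).finrank_add_finrank_orthogonal
  have h2 := finrank_designRange_le X π
  have h3 : Module.finrank ℝ (Submodule.span ℝ {μ}) ≤ 1 := by
    simpa using finrank_span_le_card (R := ℝ) ({μ} : Set (Vec n))
  have h4 := Submodule.finrank_add_le_finrank_add_finrank (designRange X π)
    (Submodule.span ℝ {μ})
  rw [finrank_euclideanSpace_fin] at h1
  change n - p - 1 ≤ Module.finrank ℝ ↥(designRange X π ⊔ Submodule.span ℝ {μ})ᗮ
  omega

lemma range_appendCol (A : Matrix (Fin n) (Fin p) ℝ) (u : Vec n) :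
    LinearMap.range (Matrix.toEuclideanLin (appendCol A u))
      = LinearMap.range (Matrix.toEuclideanLin A) ⊔ Submodule.span ℝ {u} := by
  have key (x : Fin p ⊕ Unit → ℝ) :
      Matrix.toEuclideanLin (appendCol A u) (WithLp.toLp 2 x)
        = Matrix.toEuclideanLin A (WithLp.toLp 2 (x ∘ Sum.inl)) + x (Sum.inr ()) • u := by
    ext i
    simp [Matrix.toLpLin_apply, appendCol, Matrix.fromCols_mulVec, Matrix.mulVec,
      dotProduct, mul_comm]
  ext z
  rw [Submodule.mem_sup]
  constructor
  · rintro ⟨b, rfl⟩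
    exact ⟨_, ⟨_, rfl⟩, _, Submodule.smul_mem _ _ (Submodule.mem_span_singleton_self u),
      (key b.ofLp).symm⟩
  · rintro ⟨_, ⟨b, rfl⟩, w, hw, rfl⟩
    obtain ⟨c, rfl⟩ := Submodule.mem_span_singleton.1 hw
    exact ⟨WithLp.toLp 2 (Sum.elim b.ofLp fun _ => c), by rw [key]; simp⟩

/-- The norm of the residual is the distance to the range. -/
lemma norm_resid_le {ι : Type} [Fintype ι] [DecidableEq ι] (A : Matrix (Fin n) ι ℝ)
    (y : Vec n) {z : Vec n} (hz : z ∈ LinearMap.range (Matrix.toEuclideanLin A)) :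
    ‖resid A y‖ ≤ ‖y - z‖ := by
  rw [resid, rangeProj, Submodule.starProjection_minimal]
  exact ciInf_le ⟨0, by rintro _ ⟨x, rfl⟩; exact norm_nonneg _⟩
    (⟨z, hz⟩ : LinearMap.range (Matrix.toEuclideanLin A))

/-- If a competitor `Π` fits at least as well as the truth with a repro sample `u` close to the
direction `e` of the noise, then the noise is close to the column space of `Π X` plus the span of
the true mean vector. -/
lemma norm_starProjection_orthSpace_le {X : Matrix (Fin n) (Fin p) ℝ}
    {π₀ π : Equiv.Perm (Fin n)} {β₀ : Fin p → ℝ} {σ₀ : ℝ} (hσ₀ : 0 < σ₀) {U u e : Vec n}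
    (he : ‖e‖ ≤ 1) (hU : U = ‖U‖ • e) {ε R ρ : ℝ} (hε1 : ε ≤ 1) (hu : ‖u - e‖ ≤ ε)
    (hR : 1 ≤ R) (hUR : ‖U‖ ≤ R) (hρ : 0 < ρ) (hρ' : ρ ≤ ‖resid (permDesign X π) (meanVec X π₀ β₀)‖)
    (hsmall : 4 * σ₀ * R * ε ≤ ρ)
    (hobj : reproObj X (response X π₀ β₀ σ₀ U) u π ≤ reproObj X (response X π₀ β₀ σ₀ U) u π₀) :
    ‖(orthSpace X π (meanVec X π₀ β₀)).starProjection U‖ ≤ (8 * σ₀ / ρ + 1) * (R ^ 2 * ε) := by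
  set μ := meanVec X π₀ β₀
  set Y := response X π₀ β₀ σ₀ U with hY
  set N := ‖U‖
  have hN : 0 ≤ N := norm_nonneg U
  have hε : 0 ≤ ε := (norm_nonneg _).trans hu
  have hYe : Y = μ + (σ₀ * N) • e := by
    rw [hY, response, hU, smul_smul]
  -- For the truth, replacing `e` by `u` in `Y = μ + σ₀N e` gives a point of the augmented range.
  have h0 : ‖resid (appendCol (permDesign X π₀) u) Y‖ ≤ σ₀ * N * ε := by
    refine (norm_resid_le _ _ (z := μ + (σ₀ * N) • u) ?_).trans ?_
    · rw [range_appendCol]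
      exact Submodule.add_mem_sup (meanVec_mem X π₀ β₀)
        (Submodule.smul_mem _ _ (Submodule.mem_span_singleton_self u))
    · rw [hYe, add_sub_add_left_eq_sub, ← smul_sub, norm_smul, Real.norm_of_nonneg (by positivity),
        norm_sub_rev]
      gcongr
  have h1 : ‖resid (appendCol (permDesign X π) u) Y‖ ≤ σ₀ * N * ε :=
    (pow_le_pow_iff_left₀ (norm_nonneg _) (norm_nonneg _) two_ne_zero).1 hobj |>.trans h0
  obtain ⟨x, hx, w, hw, hz⟩ : ∃ x ∈ designRange X π, ∃ w ∈ Submodule.span ℝ {u},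
      x + w = rangeProj (appendCol (permDesign X π) u) Y := by
    rw [← Submodule.mem_sup, ← range_appendCol]
    exact Submodule.starProjection_apply_mem _ _
  obtain ⟨c, rfl⟩ := Submodule.mem_span_singleton.1 hw
  rw [resid, ← hz] at h1
  -- `a` is the multiple of `e` that the competitor uses beyond the noise really present, so `μ - x`
  -- is close to `a • e`. Projecting onto `orthSpace` kills `μ - x`.
  set a := c - σ₀ * N with ha
  -- the fit rewritten in terms of the noise direction
  have h2 : ‖μ - x - a • e‖ ≤ (2 * σ₀ * N + |a|) * ε := by
    have : μ - x - a • e = (Y - (x + c • u)) + c • (u - e) := by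
      rw [hYe, ha, sub_smul, smul_sub]; abel
    rw [this]
    have hc : |c| ≤ |a| + σ₀ * N := by
      have : c = a + σ₀ * N := by rw [ha]; ring
      rw [this]
      exact (abs_add_le _ _).trans (by rw [abs_of_nonneg (by positivity : 0 ≤ σ₀ * N)])
    calc _ ≤ ‖Y - (x + c • u)‖ + ‖c • (u - e)‖ := norm_add_le _ _
      _ ≤ σ₀ * N * ε + (|a| + σ₀ * N) * ε := by
        rw [norm_smul, Real.norm_eq_abs]; gcongr
      _ = _ := by ring
  have h3 : ‖(orthSpace X π μ).starProjection (a • e)‖ ≤ (2 * σ₀ * N + |a|) * ε := by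
    have hzero : (orthSpace X π μ).starProjection (μ - x) = 0 := by
      rw [Submodule.starProjection_apply_eq_zero_iff, Submodule.orthogonal_orthogonal]
      exact Submodule.sub_mem _ (Submodule.mem_sup_right (Submodule.mem_span_singleton_self μ))
        (Submodule.mem_sup_left hx)
    have : (orthSpace X π μ).starProjection (a • e)
        = -(orthSpace X π μ).starProjection (μ - x - a • e) := by
      rw [map_sub _ (μ - x), hzero]; simp
    rw [this, norm_neg]
    exact ((orthSpace X π μ).norm_starProjection_apply_le _).trans h2
  have h4 : ρ ≤ |a| + (2 * σ₀ * N + |a|) * ε := by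
    calc ρ ≤ ‖resid (permDesign X π) μ‖ := hρ'
      _ ≤ ‖μ - x‖ := norm_resid_le _ _ hx
      _ = ‖a • e + (μ - x - a • e)‖ := by congr 1; abel
      _ ≤ ‖a • e‖ + ‖μ - x - a • e‖ := norm_add_le _ _
      _ ≤ |a| * 1 + (2 * σ₀ * N + |a|) * ε := by
        rw [norm_smul, Real.norm_eq_abs]; gcongr
      _ = _ := by ring
  -- By the smallness condition, `h4` gives `ρ ≤ 2|a| + ρ/2`: the gap between `μ` and the
  -- competitor's range forces `a` away from 0, so one may divide by it.
  have h5 : ρ / 4 ≤ |a| := by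
    have e1 : 4 * σ₀ * N * ε ≤ 4 * σ₀ * R * ε := by gcongr
    have e2 : |a| * ε ≤ |a| * 1 := by gcongr
    nlinarith
  have hapos : 0 < |a| := by linarith
  have h6 : ‖(orthSpace X π μ).starProjection e‖ ≤ (8 * σ₀ / ρ * N + 1) * ε := by
    rw [map_smul, norm_smul, Real.norm_eq_abs] at h3
    refine le_of_mul_le_mul_left (h3.trans ?_) hapos
    have : 2 * σ₀ * N ≤ |a| * (8 * σ₀ / ρ * N) := by
      calc 2 * σ₀ * N = ρ / 4 * (8 * σ₀ / ρ * N) := by field_simp; ring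
        _ ≤ _ := by gcongr
    calc _ ≤ (|a| * (8 * σ₀ / ρ * N) + |a|) * ε := by gcongr
      _ = _ := by ring
  rw [hU, map_smul, norm_smul, Real.norm_of_nonneg hN]
  calc N * ‖(orthSpace X π μ).starProjection e‖ ≤ R * ((8 * σ₀ / ρ * R + R) * ε) := by
        gcongr
        refine h6.trans ?_
        gcongr
    _ = _ := by ring

end Separation

/-! ### Coverage of the true permutation and its rate -/

section Coverage

variable {n p k : ℕ}

/-- A bound for the probability of missing the true permutation, in terms of the radius `ε` for
the repro samples and of a truncation level `R` for the noise. -/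
lemma exists_miscoverage_le (hnp : p + 1 < n) (X : Matrix (Fin n) (Fin p) ℝ)
    {π₀ : Equiv.Perm (Fin n)} (hπ₀ : π₀ ∈ sparsePerms n k) (β₀ : Fin p → ℝ) {σ₀ : ℝ}
    (hσ₀ : 0 < σ₀) (hC : 0 < Cmin k X π₀ β₀) (q : ℕ) :
    ∃ M B c ρ : ℝ, 0 ≤ M ∧ 0 ≤ B ∧ 0 < c ∧ 0 < ρ ∧ ∀ sel, IsReproRule k X sel →
      ∀ ε R : ℝ, 0 < ε → ε ≤ 1 → 1 ≤ R → R * ε ≤ ρ → ∀ L : ℕ, 0 < L →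
        jointLaw n L {ω | π₀ ∉ candidateSet sel ω.1 (response X π₀ β₀ σ₀ ω.2)}
          ≤ ENNReal.ofReal (M * (R ^ q)⁻¹ + B * (R ^ 2 * ε) ^ (n - p - 1)
            + Real.exp (-(L * (c * ε) ^ n))) := by
  obtain ⟨M, hM, htail⟩ := exists_stdGaussian_tail_le (Vec n) q
  obtain ⟨c, hc, hball⟩ := exists_le_stdGaussian_closedBall (n := n) (by omega)
  set S := (sparsePerms n k).erase π₀
  set μ := meanVec X π₀ β₀
  have hr : ∀ π ∈ S, 0 < ‖resid (permDesign X π) μ‖ := by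
    intro π hπ
    rw [norm_pos_iff, resid_permDesign, Ne, Submodule.starProjection_apply_eq_zero_iff,
      Submodule.orthogonal_orthogonal]
    exact meanVec_notMem_designRange hC hπ
  obtain ⟨ρ, hρ, hρle⟩ : ∃ ρ : ℝ, 0 < ρ ∧ ∀ π ∈ S, ρ ≤ ‖resid (permDesign X π) μ‖ := by
    rcases S.eq_empty_or_nonempty with h | h
    · exact ⟨1, one_pos, by simp [h]⟩
    · obtain ⟨π, hπ, hmin⟩ := S.exists_min_image (fun π => ‖resid (permDesign X π) μ‖) h
      exact ⟨_, hr π hπ, hmin⟩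
  set D := 8 * σ₀ / ρ + 1 with hD
  have hD0 : 0 ≤ D := by positivity
  obtain ⟨N, hN0, hN⟩ : ∃ N : ℝ, 0 ≤ N ∧ N = S.card := ⟨_, Nat.cast_nonneg _, rfl⟩
  refine ⟨M, N * (2 * D) ^ (n - p - 1), c, ρ / (4 * σ₀), hM, by positivity, hc,
    by positivity, ?_⟩
  intro sel hsel ε R hε hε1 hR hsmall L hL
  have hRpos : 0 < R := by linarith
  have hsmall' : 4 * σ₀ * R * ε ≤ ρ := by
    rw [le_div_iff₀ (by positivity)] at hsmall
    linarith
  -- At `U = 0` this is 0, which still lies in the unit ball and satisfies `U = ‖U‖ • dir U`; no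
  -- null set has to be removed.
  set dir : Vec n → Vec n := fun U => ‖U‖⁻¹ • U with hdir
  have hdirm : Measurable dir := by fun_prop
  have hdir1 (U : Vec n) : ‖dir U‖ ≤ 1 := by
    rw [hdir, norm_smul, norm_inv, norm_norm]
    exact inv_mul_le_one
  have hdirU (U : Vec n) : U = ‖U‖ • dir U := by
    rcases eq_or_ne U 0 with rfl | h
    · simp
    · rw [hdir, smul_inv_smul₀ (norm_ne_zero_iff.2 h)]
  -- `A` collects the bad noise (too long, or too close to a competitor's space); `F` is the event
  -- that no repro sample is near the noise direction.
  set A : Set (Vec n) := {U | R < ‖U‖} ∪ ⋃ π ∈ S,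
    {U | ‖(orthSpace X π μ).starProjection U‖ ≤ D * (R ^ 2 * ε)} with hA
  set F : Set ((Fin L → Vec n) × Vec n) := {ω | ∀ l, ε < ‖ω.1 l - dir ω.2‖} with hF
  have hsub : {ω : (Fin L → Vec n) × Vec n |
      π₀ ∉ candidateSet sel ω.1 (response X π₀ β₀ σ₀ ω.2)} ⊆ Set.univ ×ˢ A ∪ F := by
    rintro ⟨u, U⟩ hω
    by_contra h
    simp only [hF, Set.mem_union, Set.mem_prod, Set.mem_univ, true_and, not_or,
      Set.mem_ofPred_eq, not_forall, not_lt, hA, Set.mem_iUnion, not_exists, not_le] at h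
    obtain ⟨⟨hUR, hfar⟩, l, hl⟩ := h
    set π := sel (response X π₀ β₀ σ₀ U) (u l) with hπ
    have hne : π ≠ π₀ := by
      intro heq
      exact hω (Finset.mem_image.2 ⟨l, Finset.mem_univ _, heq⟩)
    have hmem : π ∈ S := Finset.mem_erase.2 ⟨hne, hsel.mem _ _⟩
    exact (hfar π hmem).not_ge (norm_starProjection_orthSpace_le hσ₀ (hdir1 U) (hdirU U) hε1 hl
      hR hUR hρ (hρle π hmem) hsmall' (hsel.isMin _ _ π₀ hπ₀))
  have hAle : stdGaussian (Vec n) A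
      ≤ ENNReal.ofReal (M * (R ^ q)⁻¹ + N * (2 * D) ^ (n - p - 1)
        * (R ^ 2 * ε) ^ (n - p - 1)) := by
    rw [ENNReal.ofReal_add (by positivity) (by positivity)]
    refine (measure_union_le _ _).trans (add_le_add (htail R hRpos) ?_)
    refine (measure_biUnion_finset_le _ _).trans ?_
    calc _ ≤ ∑ _π ∈ S, ENNReal.ofReal (2 * (D * (R ^ 2 * ε))) ^ (n - p - 1) :=
          Finset.sum_le_sum fun π _ => stdGaussian_norm_starProjection_le_le _ _
            (le_finrank_orthSpace X π μ)
      _ = _ := by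
          rw [Finset.sum_const, nsmul_eq_mul, ← ENNReal.ofReal_pow (by positivity),
            ← ENNReal.ofReal_natCast, ← hN, ← ENNReal.ofReal_mul (by positivity)]
          congr 1
          rw [mul_assoc, ← mul_pow, mul_assoc 2]
  have hFm : MeasurableSet F := by
    have : F = ⋂ l, {ω : (Fin L → Vec n) × Vec n | ε < ‖ω.1 l - dir ω.2‖} := by
      ext; simp [hF]
    rw [this]
    exact MeasurableSet.iInter fun l => measurableSet_lt measurable_const (by fun_prop)
  have hFle : jointLaw n L F ≤ ENNReal.ofReal (Real.exp (-(L * (c * ε) ^ n))) := by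
    rw [jointLaw, Measure.prod_apply_symm hFm]
    calc _ ≤ ∫⁻ _, ENNReal.ofReal (Real.exp (-(L * (c * ε) ^ n))) ∂(stdGaussian (Vec n)) :=
          lintegral_mono fun U => pi_stdGaussian_all_far_le hball (hdir1 U) hε hε1 L
      _ = _ := by simp
  refine (measure_mono hsub).trans ((measure_union_le _ _).trans ?_)
  rw [ENNReal.ofReal_add (by positivity) (Real.exp_pos _).le]
  refine add_le_add ?_ hFle
  rw [jointLaw, Measure.prod_prod, measure_univ, one_mul]
  exact hAle

lemma isBigO_rpow_neg_rate {a b : ℝ} (ha : 0 ≤ a) :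
    (fun L : ℕ => (L : ℝ) ^ (-b)) =O[atTop] fun L : ℕ => Real.log (L : ℝ) ^ a / (L : ℝ) ^ b := by
  refine Asymptotics.IsBigO.of_bound 1 ?_
  filter_upwards [eventually_ge_atTop 3] with L hL
  have h3 : (3 : ℝ) ≤ L := by exact_mod_cast hL
  have hlog : 1 ≤ Real.log L := by
    rw [Real.le_log_iff_exp_le (by linarith)]
    exact (Real.exp_one_lt_d9.le.trans (by norm_num)).trans h3
  have h1 : 1 ≤ Real.log L ^ a := Real.one_le_rpow hlog ha
  rw [one_mul, Real.norm_of_nonneg (by positivity), Real.norm_of_nonneg (by positivity),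
    Real.rpow_neg (by positivity), ← one_div]
  gcongr

/-- Substitute `x = L ^ γ` in the comparison of `exp (-c x)` with `x ^ (-b / γ)`. -/
lemma isLittleO_exp_neg_mul_rpow_natCast {c γ : ℝ} (hc : 0 < c) (hγ : 0 < γ) (b : ℝ) :
    (fun L : ℕ => Real.exp (-(c * (L : ℝ) ^ γ))) =o[atTop] fun L : ℕ => (L : ℝ) ^ (-b) := by
  have h := (isLittleO_exp_neg_mul_rpow_atTop hc (-b / γ)).comp_tendsto
    ((tendsto_rpow_atTop hγ).comp tendsto_natCast_atTop_atTop)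
  refine h.congr' ?_ ?_
  · exact Eventually.of_forall fun L => by simp
  · filter_upwards with L
    simp only [Function.comp]
    rw [← Real.rpow_mul (by positivity), mul_div_cancel₀ _ hγ.ne']

lemma exists_isMiscoverageBound (hnp : p + 1 < n) (X : Matrix (Fin n) (Fin p) ℝ)
    {π₀ : Equiv.Perm (Fin n)} (hπ₀ : π₀ ∈ sparsePerms n k) (β₀ : Fin p → ℝ) {σ₀ : ℝ}
    (hσ₀ : 0 < σ₀) (hC : 0 < Cmin k X π₀ β₀) :
    ∃ δ : ℕ → ℝ, ∀ sel, IsReproRule k X sel → IsMiscoverageBound X π₀ β₀ σ₀ sel δ := by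
  have hn1 : (0 : ℝ) < (n : ℝ) - 1 := by
    have : (1 : ℝ) < n := by exact_mod_cast (by omega : 1 < n)
    linarith
  have hnp' : (p : ℝ) + 1 < n := by exact_mod_cast hnp
  have ha : (0 : ℝ) ≤ ((n : ℝ) - p) / 2 := by linarith
  set b : ℝ := ((n : ℝ) - p - 1) / (2 * ((n : ℝ) - 1)) with hb
  have hrate := isBigO_rpow_neg_rate (b := b) ha
  rcases ((sparsePerms n k).erase π₀).eq_empty_or_nonempty with hS | ⟨π, hπ⟩
  -- Without competitors every sample selects `Π₀`, so any positive sequence decaying fast enough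
  -- works.
  · refine ⟨fun L => Real.exp (-(1 * (L : ℝ) ^ (1 : ℝ))), fun sel hsel =>
      ⟨fun L => Real.exp_pos _, fun L hL => ?_,
        (isLittleO_exp_neg_mul_rpow_natCast one_pos one_pos b).isBigO.trans hrate⟩⟩
    have : {ω : (Fin L → Vec n) × Vec n |
        π₀ ∉ candidateSet sel ω.1 (response X π₀ β₀ σ₀ ω.2)} = ∅ := by
      ext ω
      simp only [Set.mem_ofPred_eq, Set.mem_empty_iff_false, iff_false, not_not]
      refine Finset.mem_image.2 ⟨⟨0, by omega⟩, Finset.mem_univ _, ?_⟩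
      by_contra h
      exact Finset.notMem_empty _ (hS ▸ Finset.mem_erase.2 ⟨h, hsel.mem _ _⟩)
    rw [this, measure_empty]
    exact zero_le
  -- a competitor exists, hence `1 ≤ p` and `3 ≤ n`
  have hp : p ≠ 0 := by
    rintro rfl
    refine meanVec_notMem_designRange hC hπ ?_
    have : meanVec X π₀ β₀ = 0 := by
      ext i
      simp [meanVec]
    rw [this]
    exact Submodule.zero_mem _
  have hn3 : (3 : ℝ) ≤ n := by exact_mod_cast (by omega : 3 ≤ n)
  have hn0 : (0 : ℝ) < n := by linarith
  -- `ε = L ^ (-s)` and `R = L ^ τ`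
  set s₀ : ℝ := 1 / (2 * ((n : ℝ) - 1)) with hs₀
  have hs₀pos : 0 < s₀ := by positivity
  -- With this `τ`, `s = s₀ + 2τ` is the midpoint of `s₀` and `1 / n`. Then `R²ε = L ^ (-s₀)` yields
  -- exactly the exponent `b`, while `s < 1 / n` makes `L ε ^ n` a positive power of `L`. The gap
  -- `s₀ < 1 / n` needs `n > 2`.
  set τ : ℝ := (1 / n - s₀) / 4 with hτ
  have hs₀lt : s₀ < 1 / n := by
    rw [hs₀]
    exact one_div_lt_one_div_of_lt hn0 (by linarith)
  have hτpos : 0 < τ := by rw [hτ]; linarith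
  set s : ℝ := s₀ + 2 * τ with hs
  have hspos : 0 < s := by positivity
  have hns : 0 < 1 - n * s := by
    have h1 : s < 1 / n := by rw [hs, hτ]; linarith
    rw [lt_div_iff₀ hn0] at h1
    linarith
  have hτs : τ < s := by rw [hs]; linarith
  -- A moment order high enough that the tail `R ^ (-q) = L ^ (-τq)` is at most `L ^ (-b)`.
  obtain ⟨q, hq⟩ := exists_nat_ge (b / τ)
  rw [div_le_iff₀ hτpos] at hq
  obtain ⟨M, B, c, ρ, hM, hB, hc, hρ, hbound⟩ :=
    exists_miscoverage_le hnp X hπ₀ β₀ hσ₀ hC q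
  set bd : ℕ → ℝ := fun L => M * (((L : ℝ) ^ τ) ^ q)⁻¹
    + B * (((L : ℝ) ^ τ) ^ 2 * (L : ℝ) ^ (-s)) ^ (n - p - 1)
    + Real.exp (-(L * (c * (L : ℝ) ^ (-s)) ^ n)) with hbd
  have hcond : ∀ᶠ L : ℕ in atTop, (L : ℝ) ^ τ * (L : ℝ) ^ (-s) ≤ ρ := by
    have h := ((tendsto_rpow_neg_atTop (sub_pos.2 hτs)).comp
      tendsto_natCast_atTop_atTop).eventually_le_const hρ
    filter_upwards [h, eventually_gt_atTop 0] with L hL hL0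
    have hL0' : (0 : ℝ) < L := by exact_mod_cast hL0
    rw [← Real.rpow_add hL0']
    simpa [sub_eq_add_neg, add_comm] using hL
  classical
  -- The smallness condition on `R * ε` can fail only for finitely many `L`; there the trivial bound
  -- 1 is used.
  refine ⟨fun L => if (L : ℝ) ^ τ * (L : ℝ) ^ (-s) ≤ ρ then bd L else 1, fun sel hsel =>
    ⟨fun L => ?_, fun L hL => ?_, ?_⟩⟩
  · split_ifs
    · have := Real.exp_pos (-(L * (c * (L : ℝ) ^ (-s)) ^ n))
      simp only [hbd]
      positivity
    · exact one_pos
  · have hL1 : (1 : ℝ) ≤ L := by exact_mod_cast (by omega : 1 ≤ L)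
    have : IsProbabilityMeasure (jointLaw n L) := by unfold jointLaw; infer_instance
    split_ifs with h
    · exact hbound sel hsel _ _ (by positivity) (Real.rpow_le_one_of_one_le_of_nonpos hL1
        (by linarith)) (Real.one_le_rpow hL1 hτpos.le) h L (by omega)
    · simpa using prob_le_one
  · refine Asymptotics.IsBigO.trans ?_ hrate
    have hEq : (fun L : ℕ => if (L : ℝ) ^ τ * (L : ℝ) ^ (-s) ≤ ρ then bd L else 1) =ᶠ[atTop]
        fun L : ℕ => M * (L : ℝ) ^ (-(τ * q)) + B * (L : ℝ) ^ (-b)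
          + Real.exp (-(c ^ n * (L : ℝ) ^ (1 - n * s))) := by
      filter_upwards [hcond, eventually_gt_atTop 0] with L h hL0
      have hL0' : (0 : ℝ) < L := by exact_mod_cast hL0
      rw [if_pos h]
      have e1 : (((L : ℝ) ^ τ) ^ q)⁻¹ = (L : ℝ) ^ (-(τ * q)) := by
        rw [Real.rpow_neg hL0'.le, Real.rpow_mul_natCast hL0'.le]
      have e2 : (((L : ℝ) ^ τ) ^ 2 * (L : ℝ) ^ (-s)) ^ (n - p - 1) = (L : ℝ) ^ (-b) := by
        rw [← Real.rpow_mul_natCast hL0'.le, ← Real.rpow_add hL0',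
          ← Real.rpow_mul_natCast hL0'.le]
        congr 1
        rw [Nat.sub_sub, Nat.cast_sub (by omega), hs, hb, hs₀]
        push_cast
        ring
      have e3 : (L : ℝ) * (c * (L : ℝ) ^ (-s)) ^ n = c ^ n * (L : ℝ) ^ (1 - n * s) := by
        rw [mul_pow, ← Real.rpow_mul_natCast hL0'.le, sub_eq_add_neg, Real.rpow_add hL0',
          Real.rpow_one, neg_mul, mul_comm s]
        ring
      simp only [hbd]
      rw [e1, e2, e3]
    refine Asymptotics.IsBigO.congr' ?_ hEq.symm EventuallyEq.rfl
    refine ((Asymptotics.IsBigO.const_mul_left ?_ M).add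
      (Asymptotics.IsBigO.const_mul_left (Asymptotics.isBigO_refl _ _) B)).add
      (isLittleO_exp_neg_mul_rpow_natCast (by positivity) hns b).isBigO
    refine Asymptotics.IsBigO.of_bound 1 ?_
    filter_upwards [eventually_ge_atTop 1] with L hL
    have hL1 : (1 : ℝ) ≤ L := by exact_mod_cast hL
    rw [one_mul, Real.norm_of_nonneg (by positivity), Real.norm_of_nonneg (by positivity)]
    exact Real.rpow_le_rpow_of_exponent_le hL1 (by linarith)

end Coverage

end

theorem theorem2 {n p k : ℕ} (hnp : p + 1 < n)
    (X : Matrix (Fin n) (Fin p) ℝ) (hX : X.rank = p)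
    (π₀ : Equiv.Perm (Fin n)) (hπ₀ : π₀ ∈ sparsePerms n k)
    (β₀ : Fin p → ℝ) (σ₀ : ℝ) (hσ₀ : 0 < σ₀)
    (hC : 0 < Cmin k X π₀ β₀) :
    -- the sequence `δ_L` exists
    (∃ δ : ℕ → ℝ, ∀ sel, IsReproRule k X sel → IsMiscoverageBound X π₀ β₀ σ₀ sel δ) ∧
    -- the law used for calibration is the conditional distribution of `Y_θ` given
    -- `(S_{1,Π}(Y_θ), S_{2,Π}(Y_θ))`
    (∀ π ∈ sparsePerms n k, ∀ (β : Fin p → ℝ) (σ : ℝ), 0 < σ →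
      ∀ᵐ s ∂((stdGaussian (Vec n)).map fun U => suffStat X π (response X π β σ U)),
        condDistrib (fun U => response X π β σ U)
          (fun U => suffStat X π (response X π β σ U)) (stdGaussian (Vec n)) s
          = condLaw X π s) ∧
    -- type-I error control
    (∀ sel, IsReproRule k X sel → ∀ ls, IsLSRule X ls →
      ∀ δ : ℕ → ℝ, IsMiscoverageBound X π₀ β₀ σ₀ sel δ →
      ∀ k₀ : ℕ, k₀ ≤ k → π₀ ∈ sparsePerms n k₀ →
      ∀ α : ℝ, 0 < α → α < 1 → ∀ L : ℕ, 2 ≤ L →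
        jointLaw n L {ω | statD sel ls ω.1 (response X π₀ β₀ σ₀ ω.2) ∉
            acceptSet k₀ X sel ls α ω.1 (response X π₀ β₀ σ₀ ω.2)}
          ≤ ENNReal.ofReal (α + δ L)) := by
  exact ⟨exists_isMiscoverageBound hnp X hπ₀ β₀ hσ₀ hC,
    fun π _ β σ hσ => condDistrib_response (by omega) X π β hσ,
    fun sel hsel ls hls δ hδ k₀ _ hk₀ α hα _ L hL =>
      jointLaw_reject_le (by omega) hσ₀ hsel hls hδ hk₀ hα.le hL⟩
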